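/- Fourier expansion in a flare. Let $\mathbb{H}=\{x+iy : y>0\}$ be the upper half-plane with the hyperbolic measure $dx\,dy/y^2$, on which $\mathrm{PSL}(2,\mathbb{R})$ acts by Möbius transformations, and let $\Delta=-y^2\left(\frac{\partial^2}{\partial x^2}+\frac{\partial^2}{\partial y^2}\right)$. Let $\Gamma$ be a Fuchsian group, i.e. a discrete subgroup of $\mathrm{PSL}(2,\mathbb{R})$, of infinite covolume. Suppose that for some $\kappa>1$ the group $\Gamma$ contains the class of the matrix $\begin{pmatrix}\sqrt{\kappa}&0\\0&1/\sqrt{\kappa}\end{pmatrix}$ and admits a flare domain of width $\kappa$, i.e. a fundamental domain that contains the set $\{z\in\mathbb{H} : 1<|z|<\kappa,\ \arg z<\alpha\}$ for some $\alpha>0$. Let $\nu\in\mathbb{C}$ with $\operatorname{Re}\nu\ge 0$, and let $\phi:\mathbb{H}\to\mathbb{C}$ be a Maass form for $\Gamma$ with Laplace eigenvalue $\lambda=\frac14-\nu^2$: $\phi$ is smooth, $\phi(\gamma z)=\phi(z)$ for all $\gamma\in\Gamma$ and $z\in\mathbb{H}$, $\Delta\phi=\lambda\phi$, and $\phi$ is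 square-integrable on $\Gamma\backslash\mathbb{H}$. Then there are coefficients $b_n\in\mathbb{C}$ $(n\in\mathbb{Z})$ such that for every point $z=re^{i\theta}\in\mathbb{H}$ ($r>0$, $0<\theta<\pi$) $$\phi(z)=\sum_{n\in\mathbb{Z}} b_n\,\sqrt{\sin\theta}\;P^{-\nu}_{\mu_n}(\cos\theta)\;e\!\left(n\,\frac{\log r}{\log\kappa}\right),\qquad \mu_n=-\frac12+\frac{2\pi i n}{\log\kappa},$$ where the series converges unconditionally, $e(x)=e^{2\pi i x}$, and $P^{\rho}_{\mu}$ is the associated Legendre function of the first kind on $(-1,1)$, $$P^{\rho}_{\mu}(x)=\frac{1}{\Gamma(1-\rho)}\left(\frac{1+x}{1-x}\right)^{\rho/2}{}_2F_1\!\left(\mu+1,-\mu;1-\rho;\frac{1-x}{2}\right)$$ (here $\Gamma(\cdot)$ is the Gamma function). -/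

import Mathlib

open scoped MatrixGroups UpperHalfPlane ContDiff

noncomputable section

namespace FlareExpansion

/-- `PSL(2, ℝ)` acts on the upper half-plane by Möbius transformations
(through its embedding in `PGL(2, ℝ)`; see `pslMk_smul`). -/
instance pslAction : MulAction PSL(2, ℝ) ℍ :=
  MulAction.compHom ℍ (Matrix.ProjectiveSpecialLinearGroup.toPGL (n := Fin 2) (R := ℝ))

/-- The class of a matrix of `SL(2, ℝ)` acts as the matrix itself, i.e. by
`z ↦ (a z + b) / (c z + d)`. -/
theorem pslMk_smul (g : SL(2, ℝ)) (z : ℍ) :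
    (QuotientGroup.mk g : PSL(2, ℝ)) • z = g • z := rfl

/-- A Fuchsian group: a discrete subgroup of `PSL(2, ℝ)` (with the quotient topology). -/
def IsFuchsian (Γ : Subgroup PSL(2, ℝ)) : Prop :=
  DiscreteTopology Γ

/-- The matrix `diag(√κ, 1/√κ)`, which acts on `ℍ` by `z ↦ κ z`. -/
def dilation (κ : ℝ) (hκ : 0 < κ) : SL(2, ℝ) :=
  ⟨!![√κ, 0; 0, 1 / √κ], by
    have h : √κ ≠ 0 := (Real.sqrt_pos.mpr hκ).ne'
    simp [Matrix.det_fin_two, h]⟩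

/-- The flare `{z ∈ ℍ : 1 < |z| < κ, arg z < α}`. -/
def flare (κ α : ℝ) : Set ℍ :=
  {z | 1 < ‖(z : ℂ)‖ ∧ ‖(z : ℂ)‖ < κ ∧ Complex.arg z < α}

/-- A flare domain of width `κ` for `Γ`: a fundamental domain, with respect to the hyperbolic
measure `dx dy / y ^ 2` (the `volume` of `ℍ`), that contains a flare of width `κ`. -/
def IsFlareDomain (Γ : Subgroup PSL(2, ℝ)) (κ : ℝ) (F : Set ℍ) : Prop :=
  MeasureTheory.IsFundamentalDomain Γ F ∧ ∃ α : ℝ, 0 < α ∧ flare κ α ⊆ F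

/-- The hyperbolic Laplacian `-y ^ 2 (∂²/∂x² + ∂²/∂y²)`. -/
def hypLaplacian (f : ℍ → ℂ) (z : ℍ) : ℂ :=
  -(z.im : ℂ) ^ 2 * Laplacian.laplacian (f ∘ UpperHalfPlane.ofComplex) (z : ℂ)

/-- `f` is a Maass form for `Γ` with Laplace eigenvalue `eig`: smooth, invariant under `Γ`, an
eigenfunction of the Laplacian, and square-integrable on `Γ \ ℍ`, that is, over a fundamental
domain (for an invariant function the integral of `‖f‖ ^ 2` is the same over all of them). -/
structure IsMaassForm (Γ : Subgroup PSL(2, ℝ)) (eig : ℂ) (f : ℍ → ℂ) : Prop where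
  smooth : ContDiffOn ℝ ∞ (f ∘ UpperHalfPlane.ofComplex) {w : ℂ | 0 < w.im}
  invariant : ∀ γ ∈ Γ, ∀ z : ℍ, f (γ • z) = f z
  eigenfunction : ∀ z : ℍ, hypLaplacian f z = eig * f z
  squareIntegrable : ∃ F : Set ℍ, MeasureTheory.IsFundamentalDomain Γ F ∧
    MeasureTheory.MemLp f 2 (MeasureTheory.volume.restrict F)

/-- The associated Legendre function of the first kind (Ferrers function) `P^ν_μ (x)` of degree
`μ` and order `ν` on `-1 < x < 1`, for `ν` not a positive integer:
`Γ(1 - ν)⁻¹ ((1 + x) / (1 - x)) ^ (ν / 2) ₂F₁(μ + 1, -μ; 1 - ν; (1 - x) / 2)`. -/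
def legendreP (ν μ : ℂ) (x : ℝ) : ℂ :=
  (Complex.Gamma (1 - ν))⁻¹ * (((1 + x) / (1 - x) : ℝ) : ℂ) ^ (ν / 2) *
    ordinaryHypergeometric (μ + 1) (-μ) (1 - ν) (((1 - x) / 2 : ℝ) : ℂ)

/-- The degrees `μ_n = -1/2 + 2πin / log κ`. -/
def legendreDegree (κ : ℝ) (n : ℤ) : ℂ :=
  -1 / 2 + 2 * Real.pi * Complex.I * n / (Real.log κ : ℂ)

/-- `e(x) = exp(2πix)`. -/
def e (x : ℝ) : ℂ :=
  Complex.exp (2 * Real.pi * Complex.I * x)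

end FlareExpansion

end

namespace FlareExpansion

open Complex Filter Topology MeasureTheory

/-! ### The hypergeometric series and its differential equation. -/

section Hypergeometric

/-! In the coordinate `log z = t + iθ` the upper half-plane becomes the strip `0 < θ < π`, the
dilation becomes translation by `L = log κ`, and, `exp` being conformal, the eigenvalue equation
becomes `sin² θ (∂_t² + ∂_θ²) Ψ = -(1/4 - ν²) Ψ`. The pullback `Ψ` is smooth and `L`-periodic in
`t`, so on each horizontal line it is the sum of an absolutely convergent Fourier series
(`hasSum_stripCoeff`). Its `n`-th coefficient, as a function of `θ`, solves `u'' = (-(μ_n + 1/2)² -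
(1/4 - ν²) / sin² θ) u`. The function `w = √(sin θ) P^{-ν}_{μ_n}(cos θ)` solves the same equation,
by the hypergeometric equation.

It remains to see that square-integrability singles out the multiples of `w`
(`eq_mul_legendreMode`). The hyperbolic measure is `dt dθ / sin² θ`, and the flare lies in a
fundamental domain, so `‖Ψ‖² / θ²` is integrable near `θ = 0`. In the manner of Cauchy–Schwarz, the
integral of `‖u‖` over `[ε, 2ε]` is then `o(ε^{3/2})` along suitable `ε`
(`mean_le_of_integrableOn`). Since `w = O(√θ)` and `w' = O(1/√θ)`, averaging the constant Wronskian
of `u` and `w` over `[ε, 2ε]` shows that it is zero (`wronskian_eq_zero`). No second solution is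
needed, so the logarithmic case `ν = 0` is not special. -/

theorem ordinaryHypergeometricCoefficient_succ {a b c : ℂ} (hc : ∀ k : ℕ, c + k ≠ 0) (n : ℕ) :
    ((n : ℂ) + 1) * (c + n) * ordinaryHypergeometricCoefficient a b c (n + 1) =
      (a + n) * (b + n) * ordinaryHypergeometricCoefficient a b c n := by
  have h1 : ((n : ℂ) + 1) ≠ 0 := Nat.cast_add_one_ne_zero n
  have h2 := hc n
  have h3 : (Polynomial.eval c (ascPochhammer ℂ n)) ≠ 0 := by
    rw [Ne, ascPochhammer_eval_eq_zero_iff]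
    rintro ⟨k, -, hk⟩
    exact hc k (by rw [hk]; ring)
  have h4 : (n.factorial : ℂ) ≠ 0 := by exact_mod_cast n.factorial_ne_zero
  simp only [ordinaryHypergeometricCoefficient, ascPochhammer_succ_eval, Nat.factorial_succ,
    Nat.cast_mul, Nat.cast_add, Nat.cast_one]
  field_simp

/-- If a parameter is a nonpositive integer the coefficients vanish eventually (for `c` because the
inverse of zero is zero), so the radius is infinite. Otherwise it is exactly 1. -/
theorem one_le_radius_ordinaryHypergeometricSeries (a b c : ℂ) :
    1 ≤ (ordinaryHypergeometricSeries ℂ a b c).radius := by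
  by_cases h : ∀ k : ℕ, (k : ℂ) ≠ -a ∧ (k : ℂ) ≠ -b ∧ (k : ℂ) ≠ -c
  · exact (ordinaryHypergeometricSeries_radius_eq_one ℂ a b c h).ge
  · push Not at h
    obtain ⟨k, hk⟩ := h
    have : (ordinaryHypergeometricSeries ℂ a b c).radius = ⊤ := by
      refine FormalMultilinearSeries.radius_eq_top_of_forall_image_add_eq_zero _ (1 + k) fun n ↦ ?_
      refine ordinaryHypergeometricSeries_eq_zero_of_neg_nat a b c (k := k) ?_ (by lia)
      tauto
    simp [this]

theorem hasFPowerSeriesOnBall_ordinaryHypergeometric (a b c : ℂ) :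
    HasFPowerSeriesOnBall (ordinaryHypergeometric a b c : ℂ → ℂ)
      (ordinaryHypergeometricSeries ℂ a b c) 0 1 :=
  ((ordinaryHypergeometricSeries ℂ a b c).hasFPowerSeriesOnBall
    (one_pos.trans_le (one_le_radius_ordinaryHypergeometricSeries a b c))).mono one_pos
    (one_le_radius_ordinaryHypergeometricSeries a b c)

theorem differentiableOn_ordinaryHypergeometric (a b c : ℂ) :
    DifferentiableOn ℂ (ordinaryHypergeometric a b c : ℂ → ℂ) (Metric.ball 0 1) := by
  have h := (hasFPowerSeriesOnBall_ordinaryHypergeometric a b c).differentiableOn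
  rwa [← ENNReal.ofReal_one, Metric.eball_ofReal] at h

theorem iteratedDeriv_ordinaryHypergeometric (a b c : ℂ) (n : ℕ) :
    iteratedDeriv n (ordinaryHypergeometric a b c : ℂ → ℂ) 0 =
      n.factorial * ordinaryHypergeometricCoefficient a b c n := by
  have h := (hasFPowerSeriesOnBall_ordinaryHypergeometric a b c).factorial_smul 1 n
  rw [iteratedDeriv_eq_iteratedFDeriv, ← h, ordinaryHypergeometricSeries_apply_eq]
  simp

theorem hasSum_iteratedDeriv_ordinaryHypergeometric (a b c : ℂ) (k : ℕ) {z : ℂ} (hz : ‖z‖ < 1) :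
    HasSum (fun n : ℕ => ((n + 1).ascFactorial k : ℂ) *
        ordinaryHypergeometricCoefficient a b c (n + k) * z ^ n)
      (iteratedDeriv k (ordinaryHypergeometric a b c : ℂ → ℂ) z) := by
  have hd : DifferentiableOn ℂ (iteratedDeriv k (ordinaryHypergeometric a b c : ℂ → ℂ))
      (Metric.ball 0 1) := by
    rw [iteratedDeriv_eq_iterate]
    induction k with
    | zero => exact differentiableOn_ordinaryHypergeometric a b c
    | succ k ih =>
      rw [Function.iterate_succ_apply']
      exact ih.deriv Metric.isOpen_ball
  have h := Complex.hasSum_taylorSeries_on_ball (c := 0) (r := 1) (z := z) hd (by simpa using hz)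
  convert! h using 1
  ext n
  have h1 : iteratedDeriv n (iteratedDeriv k (ordinaryHypergeometric a b c : ℂ → ℂ)) 0 =
      iteratedDeriv (n + k) (ordinaryHypergeometric a b c : ℂ → ℂ) 0 := by
    rw [iteratedDeriv_eq_iterate, iteratedDeriv_eq_iterate, iteratedDeriv_eq_iterate,
      Function.iterate_add_apply]
  have h2 : (n.factorial : ℂ) ≠ 0 := by exact_mod_cast n.factorial_ne_zero
  rw [h1, iteratedDeriv_ordinaryHypergeometric, ← Nat.factorial_mul_ascFactorial]
  push_cast
  simp only [sub_zero, smul_eq_mul]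
  field_simp

/-- The hypergeometric differential equation. -/
theorem ordinaryHypergeometric_ode {a b c : ℂ} (hc : ∀ k : ℕ, c + k ≠ 0) {z : ℂ} (hz : ‖z‖ < 1) :
    z * (1 - z) * deriv (deriv (ordinaryHypergeometric a b c : ℂ → ℂ)) z +
      (c - (a + b + 1) * z) * deriv (ordinaryHypergeometric a b c : ℂ → ℂ) z -
      a * b * ordinaryHypergeometric a b c z = 0 := by
  set C := ordinaryHypergeometricCoefficient a b c with hC
  have h0 := hasSum_iteratedDeriv_ordinaryHypergeometric a b c 0 hz
  have h1 := hasSum_iteratedDeriv_ordinaryHypergeometric a b c 1 hz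
  have h2 := hasSum_iteratedDeriv_ordinaryHypergeometric a b c 2 hz
  have e2 : iteratedDeriv 2 (ordinaryHypergeometric a b c : ℂ → ℂ) =
      deriv (deriv (ordinaryHypergeometric a b c : ℂ → ℂ)) := by
    rw [iteratedDeriv_eq_iterate]; rfl
  rw [iteratedDeriv_zero] at h0
  rw [iteratedDeriv_one] at h1
  rw [e2] at h2
  simp only [Nat.ascFactorial] at h0 h1 h2
  have s1 : HasSum (fun n : ℕ => (n : ℂ) * C n * z ^ n)
      (z * deriv (ordinaryHypergeometric a b c : ℂ → ℂ) z) := by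
    rw [← hasSum_nat_add_iff' 1]
    simp only [Finset.range_one, Finset.sum_singleton, Nat.cast_zero, zero_mul, sub_zero]
    convert! h1.mul_left z using 1
    ext n
    push_cast
    ring
  have s2 : HasSum (fun n : ℕ => (n : ℂ) * (n + 1) * C (n + 1) * z ^ n)
      (z * deriv (deriv (ordinaryHypergeometric a b c : ℂ → ℂ)) z) := by
    rw [← hasSum_nat_add_iff' 1]
    simp only [Finset.range_one, Finset.sum_singleton, Nat.cast_zero, zero_mul, sub_zero]
    convert! h2.mul_left z using 1
    ext n
    push_cast
    ring
  have s3 : HasSum (fun n : ℕ => (n : ℂ) * (n - 1) * C n * z ^ n)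
      (z * (z * deriv (deriv (ordinaryHypergeometric a b c : ℂ → ℂ)) z)) := by
    rw [← hasSum_nat_add_iff' 1]
    simp only [Finset.range_one, Finset.sum_singleton, Nat.cast_zero, zero_mul, sub_zero]
    convert! s2.mul_left z using 1
    ext n
    push_cast
    ring
  have H := (((s2.sub s3).add (h1.mul_left c)).sub (s1.mul_left (a + b + 1))).sub
    (h0.mul_left (a * b))
  -- The coefficient of `z ^ n` is `(n + 1)(c + n) C (n + 1) - (a + n)(b + n) C n`, which the
  -- recurrence makes zero.
  have Z : (fun n : ℕ => (n : ℂ) * (n + 1) * C (n + 1) * z ^ n - (n : ℂ) * (n - 1) * C n * z ^ n +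
      c * (((n + 1 + 0) * 1 : ℕ) * C (n + 1) * z ^ n) - (a + b + 1) * ((n : ℂ) * C n * z ^ n) -
      a * b * ((1 : ℕ) * C (n + 0) * z ^ n)) = fun _ => 0 := by
    ext n
    have := ordinaryHypergeometricCoefficient_succ (a := a) (b := b) hc n
    rw [← hC] at this
    push_cast
    simp only [add_zero]
    linear_combination z ^ n * this
  rw [Z] at H
  have := H.unique hasSum_zero
  linear_combination this

end Hypergeometric

/-! ### The Legendre modes: differential equation and behaviour at `θ = 0`. -/

section Legendre

/-- The elementary factor `√(sin θ) * tan (θ / 2) ^ ν`. -/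
noncomputable def legendreWeight (ν : ℂ) (θ : ℝ) : ℂ :=
  Complex.exp ((Real.log (Real.sin θ) / 2 : ℝ) +
    ν * (Real.log (Real.sin (θ / 2)) - Real.log (Real.cos (θ / 2)) : ℝ))

/-- The hypergeometric factor of the Legendre function, as a function of the angle. -/
noncomputable def legendreFactor (ν μ : ℂ) (θ : ℝ) : ℂ :=
  ordinaryHypergeometric (μ + 1) (-μ) (1 + ν) ((Real.sin (θ / 2) ^ 2 : ℝ) : ℂ)

/-- The function `√(sin θ) * P^{-ν}_μ (cos θ)`. -/
noncomputable def legendreMode (ν μ : ℂ) (θ : ℝ) : ℂ :=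
  (√(Real.sin θ) : ℂ) * legendreP (-ν) μ (Real.cos θ)

theorem sin_half_pos {θ : ℝ} (hθ : θ ∈ Set.Ioo 0 Real.pi) : 0 < Real.sin (θ / 2) :=
  Real.sin_pos_of_pos_of_lt_pi (by linarith [hθ.1]) (by linarith [hθ.1, hθ.2])

theorem cos_half_pos {θ : ℝ} (hθ : θ ∈ Set.Ioo 0 Real.pi) : 0 < Real.cos (θ / 2) :=
  Real.cos_pos_of_mem_Ioo ⟨by linarith [hθ.1, Real.pi_pos], by linarith [hθ.2]⟩

theorem sin_eq_two_mul_half (θ : ℝ) :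
    Real.sin θ = 2 * Real.sin (θ / 2) * Real.cos (θ / 2) := by
  rw [← Real.sin_two_mul]; congr 1; ring

theorem legendreMode_eq (ν μ : ℂ) {θ : ℝ} (hθ : θ ∈ Set.Ioo 0 Real.pi) :
    legendreMode ν μ θ =
      (Complex.Gamma (1 + ν))⁻¹ * (legendreWeight ν θ * legendreFactor ν μ θ) := by
  have hs := sin_half_pos hθ
  have hc := cos_half_pos hθ
  have hsin : 0 < Real.sin θ := Real.sin_pos_of_mem_Ioo hθ
  have hcos : Real.cos θ = 1 - 2 * Real.sin (θ / 2) ^ 2 := by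
    rw [show θ = 2 * (θ / 2) by ring, Real.cos_two_mul, Real.cos_sq']; ring_nf
  have h1 : (1 - Real.cos θ) / 2 = Real.sin (θ / 2) ^ 2 := by rw [hcos]; ring
  have h2 : (1 + Real.cos θ) / (1 - Real.cos θ) =
      (Real.cos (θ / 2) / Real.sin (θ / 2)) ^ 2 := by
    rw [hcos, div_pow, Real.cos_sq']
    field_simp
    ring
  have h3 : (√(Real.sin θ) : ℂ) = Complex.exp ((Real.log (Real.sin θ) / 2 : ℝ) : ℂ) := by
    rw [← Complex.ofReal_exp, ← Real.log_sqrt hsin.le, Real.exp_log (Real.sqrt_pos.mpr hsin)]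
  have h4 : ((((1 + Real.cos θ) / (1 - Real.cos θ) : ℝ) : ℂ)) ^ (-ν / 2) =
      Complex.exp (ν * (Real.log (Real.sin (θ / 2)) - Real.log (Real.cos (θ / 2)) : ℝ)) := by
    have hpos : 0 < (Real.cos (θ / 2) / Real.sin (θ / 2)) ^ 2 := by positivity
    rw [h2, Complex.cpow_def_of_ne_zero (by exact_mod_cast hpos.ne'), ← Complex.ofReal_log hpos.le,
      Real.log_pow, Real.log_div hc.ne' hs.ne']
    congr 1
    push_cast
    ring
  rw [legendreMode, legendreP, h1, h3, h4, legendreWeight, legendreFactor, Complex.exp_add,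
    sub_neg_eq_add]
  ring

theorem hasDerivAt_legendreWeight (ν : ℂ) {θ : ℝ} (hθ : θ ∈ Set.Ioo 0 Real.pi) :
    HasDerivAt (legendreWeight ν)
      (legendreWeight ν θ * ((Real.cos θ / 2 + ν) / Real.sin θ)) θ := by
  have hs := sin_half_pos hθ
  have hc := cos_half_pos hθ
  have hsin : 0 < Real.sin θ := Real.sin_pos_of_mem_Ioo hθ
  have d1 : HasDerivAt (fun x : ℝ => Real.log (Real.sin x) / 2)
      (Real.cos θ / Real.sin θ / 2) θ :=
    ((Real.hasDerivAt_sin θ).log hsin.ne').div_const 2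
  have dh : HasDerivAt (fun x : ℝ => x / 2) (1 / 2) θ := (hasDerivAt_id θ).div_const 2
  have d2 : HasDerivAt (fun x : ℝ => Real.log (Real.sin (x / 2)) - Real.log (Real.cos (x / 2)))
      (1 / Real.sin θ) θ := by
    convert! (dh.sin.log hs.ne').sub (dh.cos.log hc.ne') using 1
    rw [sin_eq_two_mul_half]
    field_simp
    rw [Real.sin_sq]
    ring
  have := (d1.ofReal_comp.add (d2.ofReal_comp.const_mul ν)).cexp
  convert! this using 1
  simp only [legendreWeight, Pi.add_apply]
  congr 1
  have : (Real.sin θ : ℂ) ≠ 0 := by exact_mod_cast hsin.ne'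
  push_cast at this ⊢
  field_simp

theorem norm_sin_half_sq_lt_one {θ : ℝ} (hθ : θ ∈ Set.Ioo 0 Real.pi) :
    ‖((Real.sin (θ / 2) ^ 2 : ℝ) : ℂ)‖ < 1 := by
  have hc := cos_half_pos hθ
  rw [Complex.norm_real, Real.norm_of_nonneg (sq_nonneg _), Real.sin_sq]
  nlinarith

theorem hasDerivAt_comp_sin_half_sq {F : ℂ → ℂ} (hF : DifferentiableOn ℂ F (Metric.ball 0 1))
    {θ : ℝ} (hθ : θ ∈ Set.Ioo 0 Real.pi) :
    HasDerivAt (fun x : ℝ => F ((Real.sin (x / 2) ^ 2 : ℝ) : ℂ))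
      (deriv F ((Real.sin (θ / 2) ^ 2 : ℝ) : ℂ) * (Real.sin θ / 2 : ℝ)) θ := by
  have dh : HasDerivAt (fun x : ℝ => x / 2) (1 / 2) θ := (hasDerivAt_id θ).div_const 2
  have d : HasDerivAt (fun x : ℝ => Real.sin (x / 2) ^ 2) (Real.sin θ / 2) θ := by
    convert! dh.sin.pow 2 using 1
    rw [sin_eq_two_mul_half]
    push_cast
    ring
  have hm : ((Real.sin (θ / 2) ^ 2 : ℝ) : ℂ) ∈ Metric.ball (0 : ℂ) 1 := by
    simpa only [mem_ball_zero_iff] using norm_sin_half_sq_lt_one hθ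
  exact ((hF.differentiableAt (Metric.isOpen_ball.mem_nhds hm)).hasDerivAt).comp θ d.ofReal_comp

/-- The derivative of `legendreFactor`. -/
noncomputable def legendreFactorDeriv (ν μ : ℂ) (θ : ℝ) : ℂ :=
  deriv (ordinaryHypergeometric (μ + 1) (-μ) (1 + ν) : ℂ → ℂ) ((Real.sin (θ / 2) ^ 2 : ℝ) : ℂ) *
    (Real.sin θ / 2 : ℝ)

theorem hasDerivAt_legendreFactor (ν μ : ℂ) {θ : ℝ} (hθ : θ ∈ Set.Ioo 0 Real.pi) :
    HasDerivAt (legendreFactor ν μ) (legendreFactorDeriv ν μ θ) θ :=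
  hasDerivAt_comp_sin_half_sq (differentiableOn_ordinaryHypergeometric _ _ _) hθ

theorem hasDerivAt_legendreFactorDeriv {ν : ℂ} (hν : 0 ≤ ν.re) (μ : ℂ) {θ : ℝ}
    (hθ : θ ∈ Set.Ioo 0 Real.pi) :
    HasDerivAt (legendreFactorDeriv ν μ)
      (-(μ * (μ + 1)) * legendreFactor ν μ θ -
        (Real.cos θ + 2 * ν) / Real.sin θ * legendreFactorDeriv ν μ θ) θ := by
  have hsin : 0 < Real.sin θ := Real.sin_pos_of_mem_Ioo hθ
  have hs0 : (Real.sin θ : ℂ) ≠ 0 := by exact_mod_cast hsin.ne'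
  have d1 := hasDerivAt_comp_sin_half_sq ((differentiableOn_ordinaryHypergeometric (μ + 1) (-μ)
    (1 + ν)).deriv Metric.isOpen_ball) hθ
  have d2 := ((Real.hasDerivAt_sin θ).div_const 2).ofReal_comp
  convert! d1.mul d2 using 1
  -- `Re ν ≥ 0` keeps `1 + ν` away from the nonpositive integers.
  have hode := ordinaryHypergeometric_ode (a := μ + 1) (b := -μ) (c := 1 + ν) (fun k hk => by
    have := congrArg Complex.re hk
    simp only [add_re, one_re, natCast_re, zero_re] at this
    have : (0 : ℝ) ≤ k := k.cast_nonneg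
    linarith) (norm_sin_half_sq_lt_one hθ)
  have hcos : (Real.cos θ : ℂ) = 1 - 2 * ((Real.sin (θ / 2) ^ 2 : ℝ) : ℂ) := by
    have : Real.cos θ = 1 - 2 * Real.sin (θ / 2) ^ 2 := by
      rw [show θ = 2 * (θ / 2) by ring, Real.cos_two_mul, Real.cos_sq']; ring_nf
    rw [this]; push_cast; ring
  have hsin2 : (Real.sin θ : ℂ) ^ 2 =
      4 * (((Real.sin (θ / 2) ^ 2 : ℝ) : ℂ) * (1 - ((Real.sin (θ / 2) ^ 2 : ℝ) : ℂ))) := by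
    have : Real.sin θ ^ 2 = 4 * (Real.sin (θ / 2) ^ 2 * (1 - Real.sin (θ / 2) ^ 2)) := by
      rw [← Real.cos_sq', sin_eq_two_mul_half]; ring
    exact_mod_cast this
  rw [legendreFactor, legendreFactorDeriv]
  generalize deriv (deriv (ordinaryHypergeometric (μ + 1) (-μ) (1 + ν) : ℂ → ℂ)) _ = F2 at *
  generalize deriv (ordinaryHypergeometric (μ + 1) (-μ) (1 + ν) : ℂ → ℂ) _ = F1 at *
  generalize (ordinaryHypergeometric (μ + 1) (-μ) (1 + ν) : ℂ → ℂ) _ = F0 at *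
  generalize ((Real.sin (θ / 2) ^ 2 : ℝ) : ℂ) = z at *
  have e1 : ((Real.sin θ / 2 : ℝ) : ℂ) = Real.sin θ / 2 := by push_cast; ring
  have e2 : ((Real.cos θ / 2 : ℝ) : ℂ) = Real.cos θ / 2 := by push_cast; ring
  rw [e1, e2]
  generalize (Real.sin θ : ℂ) = S at *
  generalize (Real.cos θ : ℂ) = T at *
  subst hcos
  have e3 : (1 - 2 * z + 2 * ν) / S * (F1 * (S / 2)) = (1 - 2 * z + 2 * ν) * F1 / 2 := by
    field_simp
  rw [e3]
  linear_combination -hode - F2 / 4 * hsin2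

/-- The derivative of `legendreMode`. -/
noncomputable def legendreModeDeriv (ν μ : ℂ) (θ : ℝ) : ℂ :=
  (Complex.Gamma (1 + ν))⁻¹ * (legendreWeight ν θ *
    ((Real.cos θ / 2 + ν) / Real.sin θ * legendreFactor ν μ θ + legendreFactorDeriv ν μ θ))

theorem hasDerivAt_legendreMode (ν μ : ℂ) {θ : ℝ} (hθ : θ ∈ Set.Ioo 0 Real.pi) :
    HasDerivAt (legendreMode ν μ) (legendreModeDeriv ν μ θ) θ := by
  have h : HasDerivAt (fun x => (Complex.Gamma (1 + ν))⁻¹ *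
      (legendreWeight ν x * legendreFactor ν μ x)) (legendreModeDeriv ν μ θ) θ := by
    convert! (((hasDerivAt_legendreWeight ν hθ).mul
      (hasDerivAt_legendreFactor ν μ hθ)).const_mul _) using 1
    rw [legendreModeDeriv]
    ring
  exact h.congr_of_eventuallyEq
    (Filter.eventually_of_mem (isOpen_Ioo.mem_nhds hθ) fun x hx => legendreMode_eq ν μ hx)

theorem hasDerivAt_legendreModeDeriv {ν : ℂ} (hν : 0 ≤ ν.re) (μ : ℂ) {θ : ℝ}
    (hθ : θ ∈ Set.Ioo 0 Real.pi) :
    HasDerivAt (legendreModeDeriv ν μ)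
      ((-(μ + 1 / 2) ^ 2 - (1 / 4 - ν ^ 2) / (Real.sin θ : ℂ) ^ 2) * legendreMode ν μ θ) θ := by
  have hsin : 0 < Real.sin θ := Real.sin_pos_of_mem_Ioo hθ
  have hs0 : (Real.sin θ : ℂ) ≠ 0 := by exact_mod_cast hsin.ne'
  have dc := (((Real.hasDerivAt_cos θ).ofReal_comp.div_const 2).add_const ν).div
    (Real.hasDerivAt_sin θ).ofReal_comp hs0
  convert! ((hasDerivAt_legendreWeight ν hθ).mul ((dc.mul (hasDerivAt_legendreFactor ν μ hθ)).add
    (hasDerivAt_legendreFactorDeriv hν μ hθ))).const_mul _ using 1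
  have hcs : (Real.cos θ : ℂ) ^ 2 = 1 - (Real.sin θ : ℂ) ^ 2 := by
    exact_mod_cast Real.cos_sq' θ
  rw [legendreMode_eq ν μ hθ]
  simp only [Pi.add_apply, Pi.mul_apply, Pi.div_apply, Complex.ofReal_neg]
  generalize (Real.sin θ : ℂ) = S at *
  generalize (Real.cos θ : ℂ) = T at *
  generalize legendreFactor ν μ θ = G at *
  generalize legendreFactorDeriv ν μ θ = G1 at *
  generalize legendreWeight ν θ = A at *
  generalize (Complex.Gamma (1 + ν))⁻¹ = g at *
  field_simp
  linear_combination (4 * g * A * G) * hcs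

/-- The hypergeometric factor tends to 1 at `θ = 0`, the weight is an exponential, and `1 / Γ(1 +
ν)` is nonzero because `Re (1 + ν) > 0`. -/
theorem exists_legendreMode_ne_zero {ν : ℂ} (hν : 0 ≤ ν.re) (μ : ℂ) :
    ∃ θ ∈ Set.Ioo 0 Real.pi, legendreMode ν μ θ ≠ 0 := by
  have hcont : ContinuousAt (legendreFactor ν μ) 0 := by
    have h1 : ContinuousAt (ordinaryHypergeometric (μ + 1) (-μ) (1 + ν) : ℂ → ℂ) 0 :=
      ((differentiableOn_ordinaryHypergeometric _ _ _).differentiableAt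
        (Metric.ball_mem_nhds _ one_pos)).continuousAt
    refine ContinuousAt.comp (f := fun θ : ℝ => ((Real.sin (θ / 2) ^ 2 : ℝ) : ℂ)) ?_ ?_
    · simpa using h1
    · fun_prop
  have h0 : legendreFactor ν μ 0 ≠ 0 := by simp [legendreFactor]
  have hev : ∀ᶠ θ in 𝓝[>] (0 : ℝ), legendreFactor ν μ θ ≠ 0 ∧ θ ∈ Set.Ioo 0 Real.pi :=
    Filter.Eventually.and (nhdsWithin_le_nhds (hcont.eventually_ne h0))
      (Ioo_mem_nhdsGT Real.pi_pos)
  obtain ⟨θ, h, hθ⟩ := hev.exists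
  refine ⟨θ, hθ, ?_⟩
  rw [legendreMode_eq ν μ hθ]
  refine mul_ne_zero (inv_ne_zero (Complex.Gamma_ne_zero_of_re_pos ?_))
    (mul_ne_zero (Complex.exp_ne_zero _) h)
  simp; linarith

/-- The remaining factor has norm `tan (θ / 2) ^ Re ν`, at most 1 because `tan (θ / 2) ≤ 1` and `Re
ν ≥ 0`. -/
theorem norm_legendreWeight_le {ν : ℂ} (hν : 0 ≤ ν.re) {θ : ℝ} (h0 : 0 < θ) (h1 : θ ≤ 1) :
    ‖legendreWeight ν θ‖ ≤ √(Real.sin θ) := by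
  have hθ : θ ∈ Set.Ioo 0 Real.pi := ⟨h0, by linarith [Real.pi_gt_three]⟩
  have hs := sin_half_pos hθ
  have hc := cos_half_pos hθ
  have hsin : 0 < Real.sin θ := Real.sin_pos_of_mem_Ioo hθ
  rw [legendreWeight, Complex.norm_exp, ← Real.exp_log (Real.sqrt_pos.mpr hsin),
    Real.log_sqrt hsin.le, Real.exp_le_exp]
  have hle : Real.sin (θ / 2) ≤ Real.cos (θ / 2) := by
    rw [← Real.cos_pi_div_two_sub]
    exact Real.cos_le_cos_of_nonneg_of_le_pi (by linarith) (by linarith [Real.pi_gt_three])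
      (by linarith [Real.pi_gt_three])
  have := Real.log_le_log hs hle
  rw [Complex.add_re, Complex.ofReal_re, Complex.re_mul_ofReal]
  nlinarith [mul_nonneg hν (sub_nonneg.mpr this)]

/-- The hypergeometric factor and its derivative are bounded on `[0, 1]`, so the weight alone
decides the size. Differentiating it costs a factor `1 / sin θ`, comparable to `1 / θ`. -/
theorem exists_legendreMode_bounds {ν : ℂ} (hν : 0 ≤ ν.re) (μ : ℂ) :
    ∃ C : ℝ, ∀ θ : ℝ, 0 < θ → θ ≤ 1 →
      ‖legendreMode ν μ θ‖ ≤ C * √θ ∧ ‖legendreModeDeriv ν μ θ‖ ≤ C / √θ := by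
  have hmaps : Set.MapsTo (fun θ : ℝ => ((Real.sin (θ / 2) ^ 2 : ℝ) : ℂ)) (Set.Icc 0 1)
      (Metric.ball 0 1) := by
    intro θ hθ
    rcases hθ.1.eq_or_lt with h | h
    · simp [← h]
    · simpa only [mem_ball_zero_iff] using
        norm_sin_half_sq_lt_one ⟨h, by linarith [Real.pi_gt_three, hθ.2]⟩
  have hsc : ContinuousOn (fun θ : ℝ => ((Real.sin (θ / 2) ^ 2 : ℝ) : ℂ)) (Set.Icc 0 1) := by
    fun_prop
  have hd := differentiableOn_ordinaryHypergeometric (μ + 1) (-μ) (1 + ν)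
  have hG : ContinuousOn (legendreFactor ν μ) (Set.Icc 0 1) := hd.continuousOn.comp hsc hmaps
  have hG1 : ContinuousOn (legendreFactorDeriv ν μ) (Set.Icc 0 1) :=
    ((hd.deriv Metric.isOpen_ball).continuousOn.comp hsc hmaps).mul (by fun_prop)
  obtain ⟨B, hB⟩ := isCompact_Icc.exists_bound_of_continuousOn hG
  obtain ⟨B1, hB1⟩ := isCompact_Icc.exists_bound_of_continuousOn hG1
  have hB0 : 0 ≤ B := (norm_nonneg _).trans (hB 0 (by simp))
  have hB10 : 0 ≤ B1 := (norm_nonneg _).trans (hB1 0 (by simp))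
  set g := ‖(Complex.Gamma (1 + ν))⁻¹‖ with hg
  have hg0 : 0 ≤ g := norm_nonneg _
  refine ⟨g * (B + 2 * ((1 + ‖ν‖) * B + B1)), fun θ h0 h1 => ?_⟩
  have hθ : θ ∈ Set.Ioo 0 Real.pi := ⟨h0, by linarith [Real.pi_gt_three]⟩
  have hsin : 0 < Real.sin θ := Real.sin_pos_of_mem_Ioo hθ
  have hW := norm_legendreWeight_le hν h0 h1
  have hle : √(Real.sin θ) ≤ √θ := Real.sqrt_le_sqrt (Real.sin_le h0.le)
  have hθI : θ ∈ Set.Icc (0 : ℝ) 1 := ⟨h0.le, h1⟩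
  have hsθ : 0 < √θ := Real.sqrt_pos.mpr h0
  constructor
  · rw [legendreMode_eq ν μ hθ, norm_mul, norm_mul, ← hg]
    calc g * (‖legendreWeight ν θ‖ * ‖legendreFactor ν μ θ‖) ≤ g * (√θ * B) := by
          gcongr
          · exact hW.trans hle
          · exact hB θ hθI
      _ ≤ _ := by
          have : 0 ≤ g * (2 * ((1 + ‖ν‖) * B + B1)) * √θ := by positivity
          linarith
  · have hsinlow : θ / 2 ≤ Real.sin θ := by
      have := Real.mul_le_sin h0.le (by linarith [Real.pi_gt_three])
      have h4 : 2 / Real.pi ≥ 1 / 2 := by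
        rw [ge_iff_le, div_le_div_iff₀ two_pos Real.pi_pos]; linarith [Real.pi_le_four]
      nlinarith
    have hp : ‖((Real.cos θ / 2 + ν) / Real.sin θ : ℂ)‖ ≤ (1 + ‖ν‖) / Real.sin θ := by
      rw [norm_div, Complex.norm_real, Real.norm_of_nonneg hsin.le]
      gcongr
      refine (norm_add_le _ _).trans ?_
      gcongr
      rw [norm_div, Complex.norm_real, Real.norm_eq_abs]
      have := Real.abs_cos_le_one θ
      norm_num
      linarith
    have hinner : ‖((Real.cos θ / 2 + ν) / Real.sin θ : ℂ) * legendreFactor ν μ θ +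
        legendreFactorDeriv ν μ θ‖ ≤ 2 * ((1 + ‖ν‖) * B + B1) / θ := by
      calc _ ≤ (1 + ‖ν‖) / Real.sin θ * B + B1 := by
            refine (norm_add_le _ _).trans ?_
            rw [norm_mul]
            gcongr
            · exact hB θ hθI
            · exact hB1 θ hθI
        _ ≤ (1 + ‖ν‖) / (θ / 2) * B + B1 / (θ / 2) := by
            gcongr
            rw [le_div_iff₀ (by positivity)]
            nlinarith
        _ = _ := by field_simp
    rw [legendreModeDeriv, norm_mul, norm_mul, ← hg]
    calc _ ≤ g * (√θ * (2 * ((1 + ‖ν‖) * B + B1) / θ)) := by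
          gcongr
          exact hW.trans hle
      _ = g * (2 * ((1 + ‖ν‖) * B + B1)) / √θ := by
          have := Real.mul_self_sqrt h0.le
          field_simp
          rw [sq, this]
          ring
      _ ≤ _ := by
          gcongr
          linarith

end Legendre

/-! ### Solutions that are small in mean at the singular endpoint. -/

section Wronskian

/-- A solution of a second order linear equation that vanishes to first order at a point is
zero. -/
theorem eq_zero_of_second_order_ode {a b θ₀ : ℝ} {v v' q : ℝ → ℂ} (hq : ContinuousOn q (Set.Ioo a b))
    (hv : ∀ θ ∈ Set.Ioo a b, HasDerivAt v (v' θ) θ)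
    (hv' : ∀ θ ∈ Set.Ioo a b, HasDerivAt v' (q θ * v θ) θ)
    (hθ₀ : θ₀ ∈ Set.Ioo a b) (h0 : v θ₀ = 0) (h0' : v' θ₀ = 0) :
    ∀ θ ∈ Set.Ioo a b, v θ = 0 := by
  intro θ hθ
  -- On a compact subinterval containing both points `q` is bounded, so the first-order system for
  -- `(v, v')` is Lipschitz there.
  obtain ⟨c, hc1, hc2⟩ := exists_between (lt_min hθ.1 hθ₀.1)
  obtain ⟨d, hd1, hd2⟩ := exists_between (max_lt hθ.2 hθ₀.2)
  have hsub : Set.Icc c d ⊆ Set.Ioo a b :=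
    fun x hx => ⟨hc1.trans_le hx.1, hx.2.trans_lt hd2⟩
  obtain ⟨B, hB⟩ := isCompact_Icc.exists_bound_of_continuousOn (hq.mono hsub)
  have hθm : θ ∈ Set.Ioo c d :=
    ⟨hc2.trans_le (min_le_left _ _), (le_max_left _ _).trans_lt hd1⟩
  have hθ₀m : θ₀ ∈ Set.Ioo c d :=
    ⟨hc2.trans_le (min_le_right _ _), (le_max_right _ _).trans_lt hd1⟩
  have hLip : ∀ t ∈ Set.Ioo c d, LipschitzOnWith (max 1 B).toNNReal
      (fun y : ℂ × ℂ => (y.2, q t * y.1)) Set.univ := by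
    intro t ht
    refine LipschitzOnWith.of_dist_le_mul fun x _ y _ => ?_
    rw [Real.coe_toNNReal _ (zero_le_one.trans (le_max_left _ _)), Prod.dist_eq, Prod.dist_eq]
    have hm0 : 0 ≤ max (dist x.1 y.1) (dist x.2 y.2) := dist_nonneg.trans (le_max_left _ _)
    refine max_le ?_ ?_
    · calc dist x.2 y.2 ≤ 1 * max (dist x.1 y.1) (dist x.2 y.2) := by
            rw [one_mul]; exact le_max_right _ _
        _ ≤ _ := by gcongr; exact le_max_left _ _
    · simp only [dist_eq_norm, ← mul_sub, norm_mul]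
      rw [← dist_eq_norm, ← dist_eq_norm]
      exact mul_le_mul ((hB t (Set.Ioo_subset_Icc_self ht)).trans (le_max_right _ _))
        (le_max_left _ _) dist_nonneg (zero_le_one.trans (le_max_left _ _))
  have := ODE_solution_unique_of_mem_Ioo (v := fun t (y : ℂ × ℂ) => (y.2, q t * y.1))
    (s := fun _ => Set.univ) (f := fun t => (v t, v' t)) (g := fun _ => 0) hLip hθ₀m
    (fun t ht => ⟨(hv t (hsub (Set.Ioo_subset_Icc_self ht))).prodMk
      (hv' t (hsub (Set.Ioo_subset_Icc_self ht))), trivial⟩)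
    (fun t ht => ⟨(hasDerivAt_const t (0 : ℂ × ℂ)).congr_deriv (by simp; rfl), trivial⟩) (by simp [h0, h0']) hθm
  exact congrArg Prod.fst this

theorem wronskian_const {a b : ℝ} {u u' w w' q : ℝ → ℂ}
    (hu : ∀ θ ∈ Set.Ioo a b, HasDerivAt u (u' θ) θ)
    (hu' : ∀ θ ∈ Set.Ioo a b, HasDerivAt u' (q θ * u θ) θ)
    (hw : ∀ θ ∈ Set.Ioo a b, HasDerivAt w (w' θ) θ)
    (hw' : ∀ θ ∈ Set.Ioo a b, HasDerivAt w' (q θ * w θ) θ) {x y : ℝ}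
    (hx : x ∈ Set.Ioo a b) (hy : y ∈ Set.Ioo a b) :
    u x * w' x - u' x * w x = u y * w' y - u' y * w y := by
  have h : ∀ θ ∈ Set.Ioo a b, HasDerivAt (fun θ => u θ * w' θ - u' θ * w θ) 0 θ := by
    intro θ hθ
    convert! ((hu θ hθ).mul (hw' θ hθ)).sub ((hu' θ hθ).mul (hw θ hθ)) using 1
    ring
  exact isOpen_Ioo.is_const_of_deriv_eq_zero isPreconnected_Ioo
    (fun θ hθ => (h θ hθ).differentiableAt.differentiableWithinAt)
    (fun θ hθ => (h θ hθ).deriv) hx hy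

/-- If one of two solutions is small near `0` and the other one is small in mean, then their
Wronskian vanishes. -/
theorem wronskian_eq_zero {u u' w w' : ℝ → ℂ} {W : ℂ} {C : ℝ}
    (hu : ∀ θ ∈ Set.Ioc (0 : ℝ) 1, HasDerivAt u (u' θ) θ)
    (hw : ∀ θ ∈ Set.Ioc (0 : ℝ) 1, HasDerivAt w (w' θ) θ)
    (huc : ContinuousOn u' (Set.Ioc 0 1)) (hwc : ContinuousOn w' (Set.Ioc 0 1))
    (hW : ∀ θ ∈ Set.Ioc (0 : ℝ) 1, u θ * w' θ - u' θ * w θ = W)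
    (hC : ∀ θ : ℝ, 0 < θ → θ ≤ 1 → ‖w θ‖ ≤ C * √θ ∧ ‖w' θ‖ ≤ C / √θ)
    (hmean : ∀ η > 0, ∃ ε : ℝ, 0 < ε ∧ 2 * ε ≤ 1 ∧
      ∫ θ in ε..(2 * ε), ‖u θ‖ ≤ η * (ε * √ε)) :
    W = 0 := by
  have hC0 : 0 ≤ C := by
    have := (norm_nonneg _).trans (hC 1 one_pos le_rfl).1
    simpa using this
  have key : ∀ η > 0, ‖W‖ ≤ 18 * C * η := by
    intro η hη
    obtain ⟨ε, h0, h1, hint⟩ := hmean η hη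
    have hle : ε ≤ 2 * ε := by linarith
    have hI : Set.uIcc ε (2 * ε) ⊆ Set.Ioc 0 1 := by
      rw [Set.uIcc_of_le hle]
      exact fun x hx => ⟨h0.trans_le hx.1, hx.2.trans h1⟩
    have hsε : 0 < √ε := Real.sqrt_pos.mpr h0
    have hcu : ContinuousOn u (Set.uIcc ε (2 * ε)) :=
      fun x hx => (hu x (hI hx)).continuousAt.continuousWithinAt
    have hcw : ContinuousOn w (Set.uIcc ε (2 * ε)) :=
      fun x hx => (hw x (hI hx)).continuousAt.continuousWithinAt
    have hcw' := hwc.mono hI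
    have hcu' := huc.mono hI
    -- A cutoff vanishing at both ends. Since `u' w = u w' - W`, the derivative of `χ u w` is `(χ' w
    -- + 2 χ w') u - χ W`, which no longer contains `u'`. Integrating gives `W ∫ χ = ∫ g`, so no
    -- bound on `u'` is needed.
    set χ : ℝ → ℝ := fun θ => (θ - ε) * (2 * ε - θ) with hχ
    set χ' : ℝ → ℝ := fun θ => 3 * ε - 2 * θ with hχ'
    have hdχ : ∀ θ, HasDerivAt χ (χ' θ) θ := by
      intro θ
      convert! ((hasDerivAt_id θ).sub_const ε).mul ((hasDerivAt_id θ).const_sub (2 * ε)) using 1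
      simp [hχ']
      ring
    have hcχ : Continuous χ := by fun_prop
    have hcχ' : Continuous χ' := by fun_prop
    set g : ℝ → ℂ := fun θ => (χ' θ * w θ + 2 * χ θ * w' θ) * u θ with hg
    have hgc : ContinuousOn g (Set.uIcc ε (2 * ε)) := by fun_prop
    have hftc : ∫ θ in ε..(2 * ε), (g θ - (χ θ : ℂ) * W) = 0 := by
      have := intervalIntegral.integral_eq_sub_of_hasDerivAt (a := ε) (b := 2 * ε)
        (f := fun θ => (χ θ : ℂ) * (u θ * w θ)) (f' := fun θ => g θ - (χ θ : ℂ) * W) ?_ ?_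
      · rw [this]; simp [hχ]
      · intro θ hθ
        convert! (hdχ θ).ofReal_comp.mul ((hu θ (hI hθ)).mul (hw θ (hI hθ))) using 1
        simp only [hg, Pi.mul_apply]
        rw [← hW θ (hI hθ)]
        ring
      · exact ContinuousOn.intervalIntegrable (by fun_prop)
    have hχint : ∫ θ in ε..(2 * ε), (χ θ : ℂ) * W = (ε ^ 3 / 6 : ℝ) * W := by
      rw [intervalIntegral.integral_mul_const, intervalIntegral.integral_ofReal]
      congr 2
      have : ∫ θ in ε..(2 * ε), χ θ = (fun θ => -θ ^ 3 / 3 + 3 * ε * θ ^ 2 / 2 - 2 * ε ^ 2 * θ)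
          (2 * ε) - (fun θ => -θ ^ 3 / 3 + 3 * ε * θ ^ 2 / 2 - 2 * ε ^ 2 * θ) ε := by
        refine intervalIntegral.integral_eq_sub_of_hasDerivAt
          (f := fun θ => -θ ^ 3 / 3 + 3 * ε * θ ^ 2 / 2 - 2 * ε ^ 2 * θ) (fun θ _ => ?_)
          (hcχ.intervalIntegrable _ _)
        convert! (((hasDerivAt_pow 3 θ).neg.div_const 3).add
          (((hasDerivAt_pow 2 θ).const_mul (3 * ε)).div_const 2)).sub
          ((hasDerivAt_id θ).const_mul (2 * ε ^ 2)) using 1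
        simp [hχ]
        ring
      rw [this]
      ring
    rw [intervalIntegral.integral_sub hgc.intervalIntegrable
      (ContinuousOn.intervalIntegrable (by fun_prop)), hχint, sub_eq_zero] at hftc
    have hbound : ‖∫ θ in ε..(2 * ε), g θ‖ ≤ ∫ θ in ε..(2 * ε), 3 * C * (ε * √ε) * ‖u θ‖ := by
      refine intervalIntegral.norm_integral_le_of_norm_le hle ?_
        (ContinuousOn.intervalIntegrable (by fun_prop))
      refine Eventually.of_forall fun θ hθ => ?_
      have hθ0 : 0 < θ := h0.trans hθ.1
      obtain ⟨hb, hb'⟩ := hC θ hθ0 (hθ.2.trans h1)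
      rw [hg, norm_mul]
      gcongr
      have b1 : ‖(χ' θ : ℂ)‖ ≤ ε := by
        rw [Complex.norm_real, Real.norm_eq_abs, abs_le]
        constructor <;> simp only [hχ'] <;> linarith [hθ.1, hθ.2]
      have b2 : ‖(χ θ : ℂ)‖ ≤ ε ^ 2 / 2 := by
        have h2 : 0 ≤ (θ - ε) * (2 * ε - θ) :=
          mul_nonneg (by linarith [hθ.1]) (by linarith [hθ.2])
        rw [Complex.norm_real, Real.norm_of_nonneg h2]
        nlinarith [sq_nonneg (θ - ε - (2 * ε - θ))]
      have b3 : √θ ≤ 2 * √ε := by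
        rw [Real.sqrt_le_left (by positivity), mul_pow, Real.sq_sqrt h0.le]
        linarith [hθ.2]
      have b4 : √ε ≤ √θ := Real.sqrt_le_sqrt hθ.1.le
      calc ‖(χ' θ : ℂ) * w θ + 2 * χ θ * w' θ‖ ≤
            ‖(χ' θ : ℂ)‖ * ‖w θ‖ + 2 * ‖(χ θ : ℂ)‖ * ‖w' θ‖ := by
              refine (norm_add_le _ _).trans ?_
              simp
        _ ≤ ε * (C * (2 * √ε)) + 2 * (ε ^ 2 / 2) * (C / √ε) := by
              gcongr
              · exact hb.trans (by gcongr)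
              · exact hb'.trans (by gcongr)
        _ = 3 * C * (ε * √ε) := by
              have := Real.mul_self_sqrt h0.le
              field_simp
              rw [sq, this]
              ring
    rw [hftc, norm_mul, Complex.norm_real, Real.norm_of_nonneg (by positivity),
      intervalIntegral.integral_const_mul] at hbound
    -- Both sides scale as `ε³`: the exponent `3/2` in the mean condition is exactly what makes `ε`
    -- cancel.
    have h3 : ε ^ 3 / 6 * ‖W‖ ≤ 3 * C * (ε * √ε) * (η * (ε * √ε)) :=
      hbound.trans (by gcongr)
    have h4 : 3 * C * (ε * √ε) * (η * (ε * √ε)) = ε ^ 3 / 6 * (18 * C * η) := by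
      have := Real.mul_self_sqrt h0.le
      linear_combination 3 * C * η * ε ^ 2 * this
    rw [h4] at h3
    exact le_of_mul_le_mul_left h3 (by positivity)
  have : ‖W‖ ≤ 0 := by
    have ht : Tendsto (fun η : ℝ => 18 * C * η) (𝓝[>] 0) (𝓝 0) :=
      tendsto_nhdsWithin_of_tendsto_nhds (Continuous.tendsto' (by fun_prop) _ _ (by simp))
    exact ge_of_tendsto ht (eventually_mem_nhdsWithin.mono fun η hη => key η hη)
  simpa using this

/-- A solution of the Legendre equation that is square-integrable near `0` is a multiple of
`legendreMode`. -/
theorem eq_mul_legendreMode {ν : ℂ} (hν : 0 ≤ ν.re) (μ : ℂ) {u u' : ℝ → ℂ}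
    (hu : ∀ θ ∈ Set.Ioo 0 Real.pi, HasDerivAt u (u' θ) θ)
    (hu' : ∀ θ ∈ Set.Ioo 0 Real.pi, HasDerivAt u'
      ((-(μ + 1 / 2) ^ 2 - (1 / 4 - ν ^ 2) / (Real.sin θ : ℂ) ^ 2) * u θ) θ)
    (hmean : ∀ η > 0, ∃ ε : ℝ, 0 < ε ∧ 2 * ε ≤ 1 ∧
      ∫ θ in ε..(2 * ε), ‖u θ‖ ≤ η * (ε * √ε)) :
    ∃ b : ℂ, ∀ θ ∈ Set.Ioo 0 Real.pi, u θ = b * legendreMode ν μ θ := by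
  have hw := fun θ hθ => hasDerivAt_legendreMode ν μ (θ := θ) hθ
  have hw' := fun θ hθ => hasDerivAt_legendreModeDeriv hν μ (θ := θ) hθ
  obtain ⟨C, hC⟩ := exists_legendreMode_bounds hν μ
  obtain ⟨θ₀, hθ₀, hne⟩ := exists_legendreMode_ne_zero hν μ
  have hsub : Set.Ioc (0 : ℝ) 1 ⊆ Set.Ioo 0 Real.pi :=
    fun x hx => ⟨hx.1, by linarith [hx.2, Real.pi_gt_three]⟩
  have hW := wronskian_eq_zero (fun θ hθ => hu θ (hsub hθ)) (fun θ hθ => hw θ (hsub hθ))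
    (fun θ hθ => (hu' θ (hsub hθ)).continuousAt.continuousWithinAt)
    (fun θ hθ => (hw' θ (hsub hθ)).continuousAt.continuousWithinAt)
    (fun θ hθ => wronskian_const hu hu' hw hw' (hsub hθ) hθ₀) hC hmean
  refine ⟨u θ₀ / legendreMode ν μ θ₀, fun θ hθ => ?_⟩
  set b := u θ₀ / legendreMode ν μ θ₀ with hb
  have hbu : u θ₀ = b * legendreMode ν μ θ₀ := by rw [hb]; field_simp
  -- The vanishing Wronskian matches the derivatives at `θ₀` as well, so `u` and `b` times the mode
  -- have the same Cauchy data.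
  have hbu' : u' θ₀ = b * legendreModeDeriv ν μ θ₀ := by
    have : legendreMode ν μ θ₀ * (b * legendreModeDeriv ν μ θ₀ - u' θ₀) = 0 := by
      rw [hbu] at hW
      linear_combination hW
    have := (mul_eq_zero.mp this).resolve_left hne
    linear_combination -this
  have := eq_zero_of_second_order_ode (a := 0) (b := Real.pi)
    (v := fun θ => u θ - b * legendreMode ν μ θ)
    (v' := fun θ => u' θ - b * legendreModeDeriv ν μ θ)
    (q := fun θ => -(μ + 1 / 2) ^ 2 - (1 / 4 - ν ^ 2) / (Real.sin θ : ℂ) ^ 2) ?_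
    (fun θ hθ => (hu θ hθ).sub ((hw θ hθ).const_mul b))
    (fun θ hθ => ?_) hθ₀ (by simp [hbu]) (by simp [hbu']) θ hθ
  · exact sub_eq_zero.mp this
  · refine ContinuousOn.sub (by fun_prop) (ContinuousOn.div (by fun_prop) ?_ ?_)
    · exact Continuous.continuousOn (by fun_prop)
    · intro θ hθ
      exact pow_ne_zero _ (by exact_mod_cast (Real.sin_pos_of_mem_Ioo hθ).ne')
  · convert! (hu' θ hθ).sub ((hw' θ hθ).const_mul b) using 1
    ring

end Wronskian

/-! ### Fourier expansion of periodic eigenfunctions on the strip. -/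

section Strip

/-- The strip `0 < Im z < π`. -/
def strip : Set ℂ := Complex.im ⁻¹' Set.Ioo 0 Real.pi

theorem isOpen_strip : IsOpen strip := isOpen_Ioo.preimage Complex.continuous_im

theorem mem_strip {t θ : ℝ} (hθ : θ ∈ Set.Ioo 0 Real.pi) : (t + θ * I : ℂ) ∈ strip := by
  simpa [strip] using hθ

theorem contDiffOn_fderiv_apply {Ψ : ℂ → ℂ} (hΨ : ContDiffOn ℝ ∞ Ψ strip) (v : ℂ) :
    ContDiffOn ℝ ∞ (fun z => fderiv ℝ Ψ z v) strip :=
  (hΨ.fderiv_of_isOpen isOpen_strip (m := ∞) (by simp)).clm_apply contDiffOn_const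

theorem hasFDerivAt_of_mem_strip {Ψ : ℂ → ℂ} (hΨ : ContDiffOn ℝ ∞ Ψ strip) {z : ℂ}
    (hz : z ∈ strip) : HasFDerivAt Ψ (fderiv ℝ Ψ z) z :=
  ((hΨ.differentiableOn (by simp)).differentiableAt (isOpen_strip.mem_nhds hz)).hasFDerivAt

theorem hasDerivAt_horizontal {Ψ : ℂ → ℂ} (hΨ : ContDiffOn ℝ ∞ Ψ strip) {θ : ℝ}
    (hθ : θ ∈ Set.Ioo 0 Real.pi) (t : ℝ) :
    HasDerivAt (fun t : ℝ => Ψ (t + θ * I)) (fderiv ℝ Ψ (t + θ * I) 1) t := by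
  have h : HasDerivAt (fun t : ℝ => (t + θ * I : ℂ)) 1 t := by
    simpa using (hasDerivAt_id t).ofReal_comp.add_const (θ * I : ℂ)
  exact (hasFDerivAt_of_mem_strip hΨ (mem_strip hθ)).comp_hasDerivAt t h

theorem hasDerivAt_vertical {Ψ : ℂ → ℂ} (hΨ : ContDiffOn ℝ ∞ Ψ strip) {θ : ℝ}
    (hθ : θ ∈ Set.Ioo 0 Real.pi) (t : ℝ) :
    HasDerivAt (fun θ : ℝ => Ψ (t + θ * I)) (fderiv ℝ Ψ (t + θ * I) I) θ := by
  have h : HasDerivAt (fun θ : ℝ => (t + θ * I : ℂ)) I θ := by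
    simpa using ((hasDerivAt_id θ).ofReal_comp.mul_const I).const_add (t : ℂ)
  exact (hasFDerivAt_of_mem_strip hΨ (mem_strip hθ)).comp_hasDerivAt θ h

theorem continuous_horizontal {Ψ : ℂ → ℂ} (hΨ : ContinuousOn Ψ strip) {θ : ℝ}
    (hθ : θ ∈ Set.Ioo 0 Real.pi) : Continuous fun t : ℝ => Ψ (t + θ * I) :=
  hΨ.comp_continuous (by fun_prop) fun _ => mem_strip hθ

theorem hasDerivAt_integral_vertical {Ψ : ℂ → ℂ} (hΨ : ContDiffOn ℝ ∞ Ψ strip) {K : ℝ → ℂ}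
    (hK : Continuous K) (a b : ℝ) {θ : ℝ} (hθ : θ ∈ Set.Ioo 0 Real.pi) :
    HasDerivAt (fun θ : ℝ => ∫ t in a..b, K t * Ψ (t + θ * I))
      (∫ t in a..b, K t * fderiv ℝ Ψ (t + θ * I) I) θ := by
  obtain ⟨c, hc0, hcθ⟩ := exists_between hθ.1
  obtain ⟨d, hdθ, hdπ⟩ := exists_between hθ.2
  have hsub : Set.Icc c d ⊆ Set.Ioo 0 Real.pi :=
    fun x hx => ⟨hc0.trans_le hx.1, hx.2.trans_lt hdπ⟩
  have hcont : ContinuousOn (fun p : ℝ × ℝ => K p.1 * fderiv ℝ Ψ (p.1 + p.2 * I) I)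
      (Set.uIcc a b ×ˢ Set.Icc c d) := by
    refine (hK.comp continuous_fst).continuousOn.mul ?_
    exact (contDiffOn_fderiv_apply hΨ I).continuousOn.comp
      (f := fun p : ℝ × ℝ => (p.1 + p.2 * I : ℂ)) (by fun_prop) fun p hp => mem_strip (hsub hp.2)
  obtain ⟨B, hB⟩ := (isCompact_uIcc.prod isCompact_Icc).exists_bound_of_continuousOn hcont
  refine (intervalIntegral.hasDerivAt_integral_of_dominated_loc_of_deriv_le
    (𝕜 := ℝ) (F := fun θ t => K t * Ψ (t + θ * I)) (F' := fun θ t => K t * fderiv ℝ Ψ (t + θ * I) I)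
    (s := Set.Icc c d) (bound := fun _ => B)
    (Icc_mem_nhds hcθ hdθ) ?_ ?_ ?_ ?_ intervalIntegrable_const ?_).2
  · filter_upwards [isOpen_Ioo.mem_nhds hθ] with x hx
    exact (hK.mul (continuous_horizontal hΨ.continuousOn hx)).aestronglyMeasurable
  · exact (hK.mul (continuous_horizontal hΨ.continuousOn hθ)).intervalIntegrable _ _
  · exact (hK.mul (continuous_horizontal (contDiffOn_fderiv_apply hΨ I).continuousOn
      hθ)).aestronglyMeasurable
  · exact Eventually.of_forall fun t ht x hx => hB (t, x) ⟨Set.uIoc_subset_uIcc ht, hx⟩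
  · exact Eventually.of_forall fun t _ x hx => (hasDerivAt_vertical hΨ (hsub hx) t).const_mul _

/-- Integration by parts; periodicity cancels the boundary terms. -/
theorem integral_fourier_mul_deriv {L : ℝ} {g g' : ℝ → ℂ}
    (hg : ∀ t, HasDerivAt g (g' t) t) (hg' : Continuous g') (hper : g L = g 0) (n : ℤ) :
    ∫ t in 0..L, fourier (-n) (t : AddCircle L) * g' t =
      2 * Real.pi * I * n / L * ∫ t in 0..L, fourier (-n) (t : AddCircle L) * g t := by
  have hgc : Continuous g := continuous_iff_continuousAt.mpr fun t => (hg t).continuousAt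
  have hf : Continuous fun t : ℝ => (fourier (-n) (t : AddCircle L) : ℂ) :=
    (map_continuous (fourier (-n))).comp (AddCircle.continuous_mk' L)
  have hd : ∀ t : ℝ, HasDerivAt (fun t : ℝ => (fourier (-n) (t : AddCircle L) : ℂ) * g t)
      (fourier (-n) (t : AddCircle L) * g' t -
        2 * Real.pi * I * n / L * (fourier (-n) (t : AddCircle L) * g t)) t := by
    intro t
    convert! (hasDerivAt_fourier_neg L n t).mul (hg t) using 1
    ring
  have := intervalIntegral.integral_eq_sub_of_hasDerivAt (a := 0) (b := L) (fun t _ => hd t)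
    (Continuous.intervalIntegrable (by fun_prop) _ _)
  rw [intervalIntegral.integral_sub (Continuous.intervalIntegrable (by fun_prop) _ _)
    (Continuous.intervalIntegrable (by fun_prop) _ _), intervalIntegral.integral_const_mul,
    hper] at this
  rw [← sub_eq_zero, this, AddCircle.coe_period, QuotientAddGroup.mk_zero, sub_self]

/-- The Fourier coefficients along horizontal lines. -/
noncomputable def stripCoeff (L : ℝ) (Ψ : ℂ → ℂ) (n : ℤ) (θ : ℝ) : ℂ :=
  (1 / L : ℝ) * ∫ t in 0..L, fourier (-n) (t : AddCircle L) * Ψ (t + θ * I)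

theorem continuous_fourier_coe (L : ℝ) (n : ℤ) :
    Continuous fun t : ℝ => (fourier n (t : AddCircle L) : ℂ) :=
  (map_continuous (fourier n)).comp (AddCircle.continuous_mk' L)

theorem fderiv_periodic {L : ℝ} {Ψ : ℂ → ℂ} (hper : ∀ z, Ψ (z + L) = Ψ z) (v z : ℂ) :
    fderiv ℝ Ψ (z + L) v = fderiv ℝ Ψ z v := by
  have : (fun z => Ψ (z + L)) = Ψ := funext hper
  rw [← fderiv_comp_add_right, this]

theorem stripCoeff_fderiv_one {L : ℝ} {Ψ : ℂ → ℂ} (hΨ : ContDiffOn ℝ ∞ Ψ strip)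
    (hper : ∀ z, Ψ (z + L) = Ψ z) (n : ℤ) {θ : ℝ} (hθ : θ ∈ Set.Ioo 0 Real.pi) :
    stripCoeff L (fun z => fderiv ℝ Ψ z 1) n θ =
      2 * Real.pi * I * n / L * stripCoeff L Ψ n θ := by
  rw [stripCoeff, stripCoeff, integral_fourier_mul_deriv (hasDerivAt_horizontal hΨ hθ)
    (continuous_horizontal (contDiffOn_fderiv_apply hΨ 1).continuousOn hθ) ?_ n]
  · ring
  · rw [← hper (((0 : ℝ) : ℂ) + θ * I)]
    congr 1
    push_cast
    ring

theorem hasDerivAt_stripCoeff (L : ℝ) {Ψ : ℂ → ℂ} (hΨ : ContDiffOn ℝ ∞ Ψ strip) (n : ℤ) {θ : ℝ}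
    (hθ : θ ∈ Set.Ioo 0 Real.pi) :
    HasDerivAt (stripCoeff L Ψ n) (stripCoeff L (fun z => fderiv ℝ Ψ z I) n θ) θ :=
  (hasDerivAt_integral_vertical hΨ (continuous_fourier_coe L (-n)) 0 L hθ).const_mul _

theorem norm_stripCoeff_le {L : ℝ} (hL : 0 < L) (Ψ : ℂ → ℂ) (n : ℤ) (θ : ℝ) :
    ‖stripCoeff L Ψ n θ‖ ≤ (1 / L) * ∫ t in 0..L, ‖Ψ (t + θ * I)‖ := by
  have := Fact.mk hL
  rw [stripCoeff, norm_mul, Complex.norm_real, Real.norm_of_nonneg (by positivity)]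
  gcongr
  refine (intervalIntegral.norm_integral_le_integral_norm hL.le).trans_eq ?_
  simp_rw [norm_mul, fourier_apply, Circle.norm_coe, one_mul]

/-- Two integrations by parts in `t` bound the coefficients by a multiple of `1 / n²`. The Fourier
series is therefore absolutely summable and converges pointwise. -/
theorem hasSum_stripCoeff {L : ℝ} (hL : 0 < L) {Ψ : ℂ → ℂ} (hΨ : ContDiffOn ℝ ∞ Ψ strip)
    (hper : ∀ z, Ψ (z + L) = Ψ z) {θ : ℝ} (hθ : θ ∈ Set.Ioo 0 Real.pi) (t : ℝ) :
    HasSum (fun n : ℤ => stripCoeff L Ψ n θ * fourier n (t : AddCircle L)) (Ψ (t + θ * I)) := by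
  have := Fact.mk hL
  have hp : Function.Periodic (fun t : ℝ => Ψ (t + θ * I)) L := by
    intro t
    simp only
    rw [← hper (t + θ * I)]
    congr 1
    push_cast
    ring
  let f : C(AddCircle L, ℂ) := ⟨hp.lift, continuous_coinduced_dom.mpr
    (continuous_horizontal hΨ.continuousOn hθ)⟩
  have hf : ∀ t : ℝ, f t = Ψ (t + θ * I) := fun t => hp.lift_coe t
  have hcoeff : ∀ n, fourierCoeff f n = stripCoeff L Ψ n θ := by
    intro n
    rw [fourierCoeff_eq_intervalIntegral _ _ 0, stripCoeff, zero_add, Complex.real_smul]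
    simp_rw [hf, smul_eq_mul]
  have h1 := contDiffOn_fderiv_apply hΨ 1
  have hsum : Summable (fourierCoeff f) := by
    have hb : Summable fun n : ℤ => ((1 / L) * ∫ t in 0..L,
        ‖fderiv ℝ (fun z => fderiv ℝ Ψ z 1) (t + θ * I) 1‖) * (L / (2 * Real.pi)) ^ 2 *
        (1 / (n : ℝ) ^ 2) :=
      (Real.summable_one_div_int_pow.mpr one_lt_two).mul_left _
    refine hb.of_norm_bounded_eventually ?_
    rw [Filter.eventually_cofinite]
    refine (Set.finite_singleton 0).subset fun n hn => ?_
    by_contra hn0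
    refine hn ?_
    have hn0' : (n : ℝ) ≠ 0 := by exact_mod_cast hn0
    have hd := norm_stripCoeff_le hL (fun z => fderiv ℝ (fun z => fderiv ℝ Ψ z 1) z 1) n θ
    rw [stripCoeff_fderiv_one h1 (fderiv_periodic hper 1) n hθ,
      stripCoeff_fderiv_one hΨ hper n hθ, ← mul_assoc, norm_mul] at hd
    have hN : ‖(2 * Real.pi * I * n / L : ℂ) * (2 * Real.pi * I * n / L)‖ =
        (2 * Real.pi / L) ^ 2 * (n : ℝ) ^ 2 := by
      simp only [norm_mul, norm_div, Complex.norm_real, Complex.norm_I, Complex.norm_intCast,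
        Complex.norm_ofNat, Real.norm_of_nonneg Real.pi_pos.le, Real.norm_of_nonneg hL.le]
      rw [← sq_abs (n : ℝ)]
      ring
    rw [hN] at hd
    rw [hcoeff]
    have hpi := Real.pi_pos
    have hn2 : 0 < (n : ℝ) ^ 2 := by positivity
    calc ‖stripCoeff L Ψ n θ‖ = ((2 * Real.pi / L) ^ 2 * (n : ℝ) ^ 2 * ‖stripCoeff L Ψ n θ‖) *
          (L / (2 * Real.pi)) ^ 2 * (1 / (n : ℝ) ^ 2) := by field_simp
      _ ≤ _ := by gcongr
  have := has_pointwise_sum_fourier_series_of_summable hsum (t : AddCircle L)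
  simp_rw [hcoeff, hf, smul_eq_mul] at this
  exact this

theorem integrableOn_norm_strip {Ψ : ℂ → ℂ} (hΨ : ContinuousOn Ψ strip) {ε : ℝ} (h0 : 0 < ε)
    (h1 : 2 * ε ≤ 1) (L : ℝ) :
    IntegrableOn (fun p : ℝ × ℝ => ‖Ψ (p.2 + p.1 * I)‖) (Set.Ioc ε (2 * ε) ×ˢ Set.Ioc 0 L) := by
  have hc : ContinuousOn (fun p : ℝ × ℝ => ‖Ψ (p.2 + p.1 * I)‖)
      (Set.Icc ε (2 * ε) ×ˢ Set.Icc 0 L) := by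
    refine (hΨ.comp (f := fun p : ℝ × ℝ => (p.2 + p.1 * I : ℂ)) (by fun_prop) fun p hp => ?_).norm
    exact mem_strip ⟨h0.trans_le hp.1.1, by linarith [hp.1.2, Real.pi_gt_three]⟩
  exact (hc.integrableOn_compact (isCompact_Icc.prod isCompact_Icc)).mono_set
    (Set.prod_mono Set.Ioc_subset_Icc_self Set.Ioc_subset_Icc_self)

/-- Expansion of a periodic eigenfunction on the strip. -/
theorem exists_hasSum_legendreMode {L : ℝ} (hL : 0 < L) {Ψ : ℂ → ℂ} (hΨ : ContDiffOn ℝ ∞ Ψ strip)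
    (hper : ∀ z, Ψ (z + L) = Ψ z) {ν : ℂ} (hν : 0 ≤ ν.re)
    (heig : ∀ z ∈ strip, (Real.sin z.im : ℂ) ^ 2 * (fderiv ℝ (fun z => fderiv ℝ Ψ z 1) z 1 +
      fderiv ℝ (fun z => fderiv ℝ Ψ z I) z I) = -(1 / 4 - ν ^ 2) * Ψ z)
    (hmean : ∀ η > 0, ∃ ε : ℝ, 0 < ε ∧ 2 * ε ≤ 1 ∧
      ∫ p in Set.Ioc ε (2 * ε) ×ˢ Set.Ioc 0 L, ‖Ψ (p.2 + p.1 * I)‖ ≤ η * (ε * √ε)) :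
    ∃ b : ℤ → ℂ, ∀ t : ℝ, ∀ θ ∈ Set.Ioo 0 Real.pi, HasSum (fun n : ℤ =>
      b n * legendreMode ν (-1 / 2 + 2 * Real.pi * I * n / L) θ * fourier n (t : AddCircle L))
      (Ψ (t + θ * I)) := by
  have key : ∀ n : ℤ, ∃ b : ℂ, ∀ θ ∈ Set.Ioo 0 Real.pi,
      stripCoeff L Ψ n θ = b * legendreMode ν (-1 / 2 + 2 * Real.pi * I * n / L) θ := by
    intro n
    have hI := contDiffOn_fderiv_apply hΨ I
    have h1 := contDiffOn_fderiv_apply hΨ 1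
    refine eq_mul_legendreMode hν _ (fun θ hθ => hasDerivAt_stripCoeff L hΨ n hθ)
      (fun θ hθ => ?_) ?_
    · convert! hasDerivAt_stripCoeff L hI n hθ using 1
      have hs : (Real.sin θ : ℂ) ≠ 0 := by exact_mod_cast (Real.sin_pos_of_mem_Ioo hθ).ne'
      -- The eigenvalue equation trades `∂_θ²` for `∂_t²`, which acts on the `n`-th coefficient as
      -- `(2πin / L)² = (μ_n + 1/2)²`.
      have e1 : stripCoeff L (fun z => fderiv ℝ (fun z => fderiv ℝ Ψ z I) z I) n θ =
          -(1 / 4 - ν ^ 2) / (Real.sin θ : ℂ) ^ 2 * stripCoeff L Ψ n θ -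
            stripCoeff L (fun z => fderiv ℝ (fun z => fderiv ℝ Ψ z 1) z 1) n θ := by
        have hf := continuous_fourier_coe L (-n)
        have hc0 := continuous_horizontal hΨ.continuousOn hθ
        have hc1 := continuous_horizontal (contDiffOn_fderiv_apply h1 1).continuousOn hθ
        have hi0 : IntervalIntegrable (fun t : ℝ => -(1 / 4 - ν ^ 2) / (Real.sin θ : ℂ) ^ 2 *
            (fourier (-n) (t : AddCircle L) * Ψ (t + θ * I))) volume 0 L :=
          Continuous.intervalIntegrable (continuous_const.mul (hf.mul hc0)) _ _
        have hi1 : IntervalIntegrable (fun t : ℝ => fourier (-n) (t : AddCircle L) *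
            fderiv ℝ (fun z => fderiv ℝ Ψ z 1) (t + θ * I) 1) volume 0 L :=
          Continuous.intervalIntegrable (by fun_prop) _ _
        rw [stripCoeff, stripCoeff, stripCoeff, mul_left_comm, ← mul_sub,
          ← intervalIntegral.integral_const_mul (-(1 / 4 - ν ^ 2) / (Real.sin θ : ℂ) ^ 2),
          ← intervalIntegral.integral_sub
            hi0 hi1]
        congr 1
        refine intervalIntegral.integral_congr fun t _ => ?_
        have := heig _ (mem_strip (t := t) hθ)
        have him : (t + θ * I : ℂ).im = θ := by simp
        rw [him] at this
        field_simp
        linear_combination 4 * this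
      rw [e1, stripCoeff_fderiv_one h1 (fderiv_periodic hper 1) n hθ,
        stripCoeff_fderiv_one hΨ hper n hθ]
      ring
    · intro η hη
      obtain ⟨ε, h0, h1, h⟩ := hmean (L * η) (by positivity)
      refine ⟨ε, h0, h1, ?_⟩
      have hsub : Set.uIcc ε (2 * ε) ⊆ Set.Ioo 0 Real.pi := by
        rw [Set.uIcc_of_le (by linarith)]
        exact fun x hx => ⟨h0.trans_le hx.1, by linarith [hx.2, Real.pi_gt_three]⟩
      have hint := integrableOn_norm_strip hΨ.continuousOn h0 h1 L
      have hprod := setIntegral_prod _ hint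
      simp_rw [← intervalIntegral.integral_of_le hL.le] at hprod
      rw [IntegrableOn, Measure.volume_eq_prod, ← Measure.prod_restrict] at hint
      calc ∫ θ in ε..(2 * ε), ‖stripCoeff L Ψ n θ‖ ≤
            ∫ θ in ε..(2 * ε), (1 / L) * ∫ t in 0..L, ‖Ψ (t + θ * I)‖ := by
            refine intervalIntegral.integral_mono_on (by linarith) ?_ ?_
              fun θ _ => norm_stripCoeff_le hL Ψ n θ
            · exact ContinuousOn.intervalIntegrable fun θ hθ =>
                (hasDerivAt_stripCoeff L hΨ n (hsub hθ)).continuousAt.norm.continuousWithinAt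
            · have := hint.integral_prod_left.const_mul (1 / L)
              simp_rw [← intervalIntegral.integral_of_le hL.le] at this
              exact (intervalIntegrable_iff_integrableOn_Ioc_of_le (by linarith)).mpr this
        _ ≤ (1 / L) * (L * η * (ε * √ε)) := by
            rw [intervalIntegral.integral_const_mul]
            gcongr
            rwa [intervalIntegral.integral_of_le (by linarith), ← hprod]
        _ = η * (ε * √ε) := by field_simp
  choose b hb using key
  refine ⟨b, fun t θ hθ => ?_⟩
  have := hasSum_stripCoeff hL hΨ hper hθ t
  simp_rw [hb _ θ hθ] at this
  exact this

end Strip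

/-! ### The Laplacian under the conformal map `exp`. -/

section Exponential

theorem exp_im_pos {z : ℂ} (hz : z ∈ strip) : 0 < (Complex.exp z).im := by
  rw [Complex.exp_im]
  exact mul_pos (Real.exp_pos _) (Real.sin_pos_of_mem_Ioo hz)

theorem contDiffOn_comp_exp {f : ℂ → ℂ} (hf : ContDiffOn ℝ ∞ f {w | 0 < w.im}) :
    ContDiffOn ℝ ∞ (fun z => f (Complex.exp z)) strip :=
  hf.comp (Complex.contDiff_exp (𝕜 := ℝ)).contDiffOn fun _ => exp_im_pos

theorem laplacian_eq_fderiv_fderiv (f : ℂ → ℂ) (z : ℂ) :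
    Laplacian.laplacian f z =
      fderiv ℝ (fderiv ℝ f) z 1 1 + fderiv ℝ (fderiv ℝ f) z I I := by
  rw [InnerProductSpace.laplacian_eq_iteratedFDeriv_complexPlane]
  simp [iteratedFDeriv_two_apply]

/-- The Laplacian in logarithmic polar coordinates. -/
theorem laplacian_comp_exp {f : ℂ → ℂ} (hf : ContDiffOn ℝ ∞ f {w | 0 < w.im}) {z : ℂ}
    (hz : z ∈ strip) :
    fderiv ℝ (fun y => fderiv ℝ (fun x => f (Complex.exp x)) y 1) z 1 +
      fderiv ℝ (fun y => fderiv ℝ (fun x => f (Complex.exp x)) y I) z I =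
      (‖Complex.exp z‖ : ℂ) ^ 2 * Laplacian.laplacian f (Complex.exp z) := by
  have hU : IsOpen {w : ℂ | 0 < w.im} := isOpen_lt continuous_const Complex.continuous_im
  have hexp : ∀ y : ℂ, HasFDerivAt Complex.exp
      ((ContinuousLinearMap.mul ℝ ℂ) (Complex.exp y)) y := by
    intro y
    refine ((Complex.hasDerivAt_exp y).hasFDerivAt.restrictScalars ℝ).congr_fderiv ?_
    ext
    simp [mul_comm]
  have hd1 : ∀ y ∈ strip, ∀ v, fderiv ℝ (fun x => f (Complex.exp x)) y v =
      fderiv ℝ f (Complex.exp y) (Complex.exp y * v) := by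
    intro y hy v
    have h := ((hf.differentiableOn (by simp)).differentiableAt
      (hU.mem_nhds (exp_im_pos hy))).hasFDerivAt.comp y (hexp y)
    rw [show (fun x => f (Complex.exp x)) = f ∘ Complex.exp from rfl, h.fderiv]
    simp
  have hf2 : DifferentiableAt ℝ (fderiv ℝ f) (Complex.exp z) :=
    ((hf.fderiv_of_isOpen hU (m := ∞) (by simp)).differentiableOn (by simp)).differentiableAt
      (hU.mem_nhds (exp_im_pos hz))
  have hd2 : ∀ v, fderiv ℝ (fun y => fderiv ℝ (fun x => f (Complex.exp x)) y v) z v =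
      fderiv ℝ (fderiv ℝ f) (Complex.exp z) (Complex.exp z * v) (Complex.exp z * v) +
        fderiv ℝ f (Complex.exp z) (Complex.exp z * v * v) := by
    intro v
    have h1 : HasFDerivAt (fun y => fderiv ℝ f (Complex.exp y))
        ((fderiv ℝ (fderiv ℝ f) (Complex.exp z)).comp
          ((ContinuousLinearMap.mul ℝ ℂ) (Complex.exp z))) z :=
      hf2.hasFDerivAt.comp z (hexp z)
    have h2 := (hexp z).mul_const v
    have h3 := h1.clm_apply h2
    have h4 : (fun y => fderiv ℝ (fun x => f (Complex.exp x)) y v) =ᶠ[𝓝 z]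
        fun y => fderiv ℝ f (Complex.exp y) (Complex.exp y * v) :=
      Filter.eventually_of_mem (isOpen_strip.mem_nhds hz) fun y hy => hd1 y hy v
    rw [h4.fderiv_eq, h3.fderiv]
    simp [mul_comm, add_comm]
  rw [hd2, hd2, laplacian_eq_fderiv_fderiv f _]
  set B := fderiv ℝ (fderiv ℝ f) (Complex.exp z)
  set w := Complex.exp z
  have hn : (‖w‖ : ℂ) ^ 2 = ((w.re ^ 2 + w.im ^ 2 : ℝ) : ℂ) := by
    rw [← Complex.ofReal_pow, Complex.sq_norm, Complex.normSq_apply]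
    congr 1
    ring
  have hw1 : w * 1 = w.re • (1 : ℂ) + w.im • I := by
    simp [Complex.real_smul]
  have hwI : w * I = w.re • I - w.im • (1 : ℂ) := by
    apply Complex.ext <;> simp
  -- The first-order terms cancel because `1² + I² = 0`: this is the harmonicity of `exp`.
  have h0 : fderiv ℝ f w (w * 1 * 1) + fderiv ℝ f w (w * I * I) = 0 := by
    rw [← map_add]
    simp [mul_assoc]
  rw [hn, hwI, hw1]
  rw [hwI, hw1] at h0
  simp only [map_add, map_sub, map_smul, add_apply, sub_apply, smul_apply]
  simp only [Complex.real_smul]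
  push_cast
  linear_combination h0

end Exponential

/-! ### Hyperbolic measure on the flare and the mean estimate. -/

section Measure

instance secondCountableTopology_sl : SecondCountableTopology SL(2, ℝ) :=
  inferInstanceAs (SecondCountableTopology {A : Fin 2 → Fin 2 → ℝ // Matrix.det A = 1})

/-- A discrete second countable space is countable. Countability is what allows integrals over two
fundamental domains to be compared. -/
theorem IsFuchsian.countable {Γ : Subgroup PSL(2, ℝ)} (h : IsFuchsian Γ) : Countable Γ := by
  have : DiscreteTopology Γ := h
  have : SecondCountableTopology PSL(2, ℝ) :=
    inferInstanceAs (SecondCountableTopology (SL(2, ℝ) ⧸ Subgroup.center SL(2, ℝ)))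
  exact TopologicalSpace.separableSpace_iff_countable.mp inferInstance

instance measurableConstSMul_psl : MeasurableConstSMul PSL(2, ℝ) ℍ where
  measurable_const_smul c := by
    induction c using QuotientGroup.induction_on with
    | H g => exact (continuous_const_smul g : Continuous fun z : ℍ => g • z).measurable

instance smulInvariantMeasure_psl : SMulInvariantMeasure PSL(2, ℝ) ℍ volume where
  measure_preimage_smul c s _ := by
    induction c using QuotientGroup.induction_on with
    | H g => exact measure_preimage_smul volume (g : GL (Fin 2) ℝ) s

theorem setLIntegral_upperHalfPlane (h : ℂ → ℝ) {s : Set ℍ} (hs : MeasurableSet s) :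
    ∫⁻ z in s, ENNReal.ofReal (h z) =
      ∫⁻ w in UpperHalfPlane.coe '' s, ENNReal.ofReal (1 / w.im ^ 2 * h w) := by
  have hp : MeasurePreserving UpperHalfPlane.coe (volume.comap UpperHalfPlane.coe)
      (volume.restrict (.range UpperHalfPlane.coe)) :=
    ⟨UpperHalfPlane.measurable_coe, by rw [UpperHalfPlane.measurableEmbedding_coe.map_comap]⟩
  have h1 := hp.setLIntegral_comp_emb UpperHalfPlane.measurableEmbedding_coe
    (fun w => ENNReal.ofReal (1 / w.im ^ 2 * h w)) s
  rw [Measure.restrict_restrict' UpperHalfPlane.measurableEmbedding_coe.measurableSet_range,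
    Set.inter_eq_self_of_subset_left (Set.image_subset_range _ _)] at h1
  rw [← h1, UpperHalfPlane.volume_def,
    setLIntegral_withDensity_eq_setLIntegral_mul_non_measurable _ _ _ hs]
  · refine lintegral_congr fun z => ?_
    rw [ENNReal.ofReal_mul (by positivity), Pi.mul_apply]
    congr 1
    rw [← ENNReal.ofReal_coe_nnreal]
    congr 1
    push_cast
    simp
  · exact Eventually.of_forall fun _ => ENNReal.coe_lt_top
  · refine (Continuous.measurable ?_).coe_nnreal_ennreal
    refine .pow (.div₀ continuous_const ?_ ?_) _
    · exact UpperHalfPlane.continuous_im.subtype_mk _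
    · exact fun x => NNReal.ne_iff.mp x.im_ne_zero

theorem det_mul_left (w : ℂ) : ((ContinuousLinearMap.mul ℝ ℂ) w).det = ‖w‖ ^ 2 := by
  have : ((ContinuousLinearMap.mul ℝ ℂ) w).det = Algebra.norm ℝ w := rfl
  rw [this, Algebra.norm_complex_apply, Complex.sq_norm]

theorem measurableSet_flare (κ α : ℝ) : MeasurableSet (flare κ α) := by
  have hc := UpperHalfPlane.measurable_coe
  refine (measurableSet_lt measurable_const hc.norm).inter
    ((measurableSet_lt hc.norm measurable_const).inter
      (measurableSet_lt (Complex.measurable_arg.comp hc) measurable_const))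

/-- Under `exp` the Jacobian `‖e^z‖²` cancels against `y² = ‖e^z‖² sin² θ`, leaving `dt dθ / sin²
θ`, and `sin θ ≤ θ`. The bound `β ≤ 1` keeps the rectangle inside the strip, where `exp` is
injective. -/
theorem lintegral_logPolar_le_flare (h : ℂ → ℝ) (hh : ∀ w, 0 ≤ h w) {L α β : ℝ}
    (hβα : β ≤ α) (hβ : β ≤ 1) :
    ∫⁻ p in Set.Ioo 0 β ×ˢ Set.Ioo 0 L,
        ENNReal.ofReal (h (Complex.exp (p.2 + p.1 * I)) / p.1 ^ 2) ≤
      ∫⁻ z in flare (Real.exp L) α, ENNReal.ofReal (h z) := by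
  let T : ℝ × ℝ ≃ᵐ ℂ := MeasurableEquiv.prodComm.trans Complex.measurableEquivRealProd.symm
  have hT : MeasurePreserving T volume volume :=
    (Complex.volume_preserving_equiv_real_prod.symm _).comp Measure.measurePreserving_swap
  have hTa : ∀ p : ℝ × ℝ, T p = p.2 + p.1 * I := fun p => by
    apply Complex.ext <;> simp [T] <;> rfl
  set R : Set ℂ := Set.Ioo 0 L ×ℂ Set.Ioo 0 β with hR
  have hRm : MeasurableSet R := (isOpen_Ioo.reProdIm isOpen_Ioo).measurableSet
  have hRs : ∀ z ∈ R, z ∈ strip := fun z hz =>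
    ⟨hz.2.1, by linarith [hz.2.2, Real.pi_gt_three]⟩
  have hpre : T ⁻¹' R = Set.Ioo 0 β ×ˢ Set.Ioo 0 L := by
    ext p
    simp [hR, hTa, Complex.mem_reProdIm]
    tauto
  have hinj : Set.InjOn Complex.exp R := by
    intro x hx y hy hxy
    have h1 := hRs x hx
    have h2 := hRs y hy
    rw [← Complex.log_exp (x := x), ← Complex.log_exp (x := y), hxy]
    · linarith [h2.1, Real.pi_pos]
    · exact h2.2.le
    · linarith [h1.1, Real.pi_pos]
    · exact h1.2.le
  have hexp : ∀ y ∈ R, HasFDerivWithinAt Complex.exp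
      ((ContinuousLinearMap.mul ℝ ℂ) (Complex.exp y)) R y := by
    intro y _
    refine (((Complex.hasDerivAt_exp y).hasFDerivAt.restrictScalars ℝ).congr_fderiv
      ?_).hasFDerivWithinAt
    ext
    simp [mul_comm]
  have himg : Complex.exp '' R ⊆ UpperHalfPlane.coe '' flare (Real.exp L) α := by
    rintro _ ⟨z, hz, rfl⟩
    have hzs := hRs z hz
    refine ⟨⟨Complex.exp z, exp_im_pos hzs⟩, ⟨?_, ?_, ?_⟩, rfl⟩
    · rw [UpperHalfPlane.coe_mk, Complex.norm_exp]
      exact Real.one_lt_exp_iff.mpr hz.1.1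
    · rw [UpperHalfPlane.coe_mk, Complex.norm_exp]
      exact Real.exp_lt_exp.mpr hz.1.2
    · rw [UpperHalfPlane.coe_mk, Complex.arg_exp,
        toIocMod_eq_self _ |>.mpr ⟨by linarith [hzs.1, Real.pi_pos], by linarith [hzs.2]⟩]
      exact hz.2.2.trans_le hβα
  calc _ = ∫⁻ z in R, ENNReal.ofReal (h (Complex.exp z) / z.im ^ 2) := by
        rw [← hpre, ← hT.setLIntegral_comp_preimage_emb T.measurableEmbedding]
        refine lintegral_congr fun p => ?_
        rw [hTa]
        simp
    _ ≤ ∫⁻ z in R, ENNReal.ofReal |((ContinuousLinearMap.mul ℝ ℂ) (Complex.exp z)).det| *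
          ENNReal.ofReal (1 / (Complex.exp z).im ^ 2 * h (Complex.exp z)) := by
        refine setLIntegral_mono' hRm fun z hz => ?_
        rw [← ENNReal.ofReal_mul (abs_nonneg _), det_mul_left, abs_of_nonneg (by positivity),
          Complex.norm_exp, Complex.exp_im]
        refine ENNReal.ofReal_le_ofReal ?_
        have hs : 0 < Real.sin z.im := Real.sin_pos_of_mem_Ioo (hRs z hz)
        have hz0 : 0 < z.im := hz.2.1
        have := Real.sin_le hz0.le
        calc h (Complex.exp z) / z.im ^ 2 ≤ h (Complex.exp z) / Real.sin z.im ^ 2 := by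
              gcongr
              exact hh _
          _ = _ := by
              have := Real.exp_pos z.re
              field_simp
    _ = ∫⁻ w in Complex.exp '' R, ENNReal.ofReal (1 / w.im ^ 2 * h w) :=
        (lintegral_image_eq_lintegral_abs_det_fderiv_mul volume hRm hexp hinj
          (fun w => ENNReal.ofReal (1 / w.im ^ 2 * h w))).symm
    _ ≤ ∫⁻ w in UpperHalfPlane.coe '' flare (Real.exp L) α,
          ENNReal.ofReal (1 / w.im ^ 2 * h w) := lintegral_mono_set himg
    _ = _ := (setLIntegral_upperHalfPlane h (measurableSet_flare _ _)).symm

theorem mean_le_of_integrableOn {Ψ : ℂ → ℂ} (hΨ : ContinuousOn Ψ strip) {L β : ℝ} (hL : 0 < L)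
    (hβ0 : 0 < β) (hβ : β ≤ 1) (hint : IntegrableOn
      (fun p : ℝ × ℝ => ‖Ψ (p.2 + p.1 * I)‖ ^ 2 / p.1 ^ 2) (Set.Ioo 0 β ×ˢ Set.Ioo 0 L)) :
    ∀ η > 0, ∃ ε : ℝ, 0 < ε ∧ 2 * ε ≤ 1 ∧
      ∫ p in Set.Ioc ε (2 * ε) ×ˢ Set.Ioc 0 L, ‖Ψ (p.2 + p.1 * I)‖ ≤ η * (ε * √ε) := by
  intro η hη
  set g : ℝ × ℝ → ℝ := fun p => ‖Ψ (p.2 + p.1 * I)‖ ^ 2 / p.1 ^ 2 with hg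
  set Q : ℝ → Set (ℝ × ℝ) := fun ε => Set.Ioo ε (2 * ε) ×ˢ Set.Ioo 0 L with hQ
  have hvol : ∀ ε > 0, volume (Q ε) = ENNReal.ofReal (ε * L) := by
    intro ε hε
    rw [hQ, Measure.volume_eq_prod, Measure.prod_prod, Real.volume_Ioo, Real.volume_Ioo,
      ← ENNReal.ofReal_mul (by linarith)]
    congr 1
    ring
  -- Absolute continuity of the integral: the area of `Q ε` tends to 0.
  have ht : Tendsto (fun ε => ∫ p in Q ε, g p ∂(volume.restrict (Set.Ioo 0 β ×ˢ Set.Ioo 0 L)))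
      (𝓝[>] 0) (𝓝 0) := by
    refine Integrable.tendsto_setIntegral_nhds_zero hint ?_
    have h1 : Tendsto (fun ε : ℝ => ENNReal.ofReal (ε * L)) (𝓝[>] 0) (𝓝 0) := by
      refine tendsto_nhdsWithin_of_tendsto_nhds ?_
      exact (ENNReal.continuous_ofReal.comp (continuous_mul_const L)).tendsto' _ _ (by simp)
    refine tendsto_of_tendsto_of_tendsto_of_le_of_le' tendsto_const_nhds h1
      (Eventually.of_forall fun _ => zero_le) ?_
    filter_upwards [self_mem_nhdsWithin] with ε hε
    exact (Measure.restrict_apply_le _ _).trans (hvol ε hε).le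
  -- `δ` balances `G ≤ δ√ε + G² / (4δ√ε)`, a pointwise form of Cauchy–Schwarz: each term then
  -- contributes at most half of `η ε√ε`.
  set δ := η / (2 * L) with hδ
  have hδ0 : 0 < δ := by positivity
  obtain ⟨ε, hsmall, hε⟩ := ((ht.eventually_lt_const (u := η * δ / 2) (by positivity)).and
    (Ioo_mem_nhdsGT (show (0 : ℝ) < β / 2 by positivity))).exists
  have hε0 : 0 < ε := hε.1
  have hε1 : 2 * ε ≤ 1 := by linarith [hε.2]
  refine ⟨ε, hε0, hε1, ?_⟩
  have hsub : Q ε ⊆ Set.Ioo 0 β ×ˢ Set.Ioo 0 L :=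
    Set.prod_mono (Set.Ioo_subset_Ioo hε0.le (by linarith [hε.2])) subset_rfl
  have hQm : MeasurableSet (Q ε) := measurableSet_Ioo.prod measurableSet_Ioo
  rw [Measure.restrict_restrict hQm, Set.inter_eq_self_of_subset_left hsub] at hsmall
  have hsε : 0 < √ε := Real.sqrt_pos.mpr hε0
  have hset : (Set.Ioc ε (2 * ε) ×ˢ Set.Ioc 0 L : Set (ℝ × ℝ)) =ᵐ[volume] Q ε :=
    Measure.set_prod_ae_eq Ioo_ae_eq_Ioc.symm Ioo_ae_eq_Ioc.symm
  rw [setIntegral_congr_set hset]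
  have hG : IntegrableOn (fun p : ℝ × ℝ => ‖Ψ (p.2 + p.1 * I)‖) (Q ε) :=
    (integrableOn_norm_strip hΨ hε0 hε1 L).congr_set_ae hset.symm
  have hgQ : IntegrableOn g (Q ε) := hint.mono_set hsub
  have hfin : volume (Q ε) ≠ ⊤ := by rw [hvol ε hε0]; exact ENNReal.ofReal_ne_top
  have hci : Integrable (fun _ : ℝ × ℝ => δ * √ε) (volume.restrict (Q ε)) :=
    integrableOn_const hfin
  calc ∫ p in Q ε, ‖Ψ (p.2 + p.1 * I)‖ ≤ ∫ p in Q ε, (δ * √ε + ε * √ε / δ * g p) := by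
        refine setIntegral_mono_on hG (hci.add (hgQ.const_mul _)) hQm ?_
        rintro ⟨θ, t⟩ ⟨hθ, -⟩
        simp only [hg]
        set G := ‖Ψ (t + θ * I)‖
        have hG0 : 0 ≤ G := norm_nonneg _
        have hθ0 : 0 < θ := hε0.trans hθ.1
        have hε2 := Real.mul_self_sqrt hε0.le
        have h1 : G ^ 2 / (4 * ε ^ 2) ≤ G ^ 2 / θ ^ 2 := by
          gcongr
          nlinarith [hθ.2]
        have h2 : G ≤ δ * √ε + ε * √ε / δ * (G ^ 2 / (4 * ε ^ 2)) := by
          have e1 : ε * √ε / δ * (G ^ 2 / (4 * ε ^ 2)) = G ^ 2 / (4 * δ * √ε) := by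
            field_simp
            rw [sq, hε2]
          have e2 : δ * √ε + G ^ 2 / (4 * δ * √ε) - G =
              (2 * (δ * √ε) - G) ^ 2 / (4 * δ * √ε) := by
            field_simp
            ring
          have e3 : 0 ≤ (2 * (δ * √ε) - G) ^ 2 / (4 * δ * √ε) := by positivity
          rw [e1]
          linarith
        refine h2.trans ?_
        gcongr
    _ = δ * √ε * (ε * L) + ε * √ε / δ * ∫ p in Q ε, g p := by
        rw [integral_add hci (hgQ.const_mul _), setIntegral_const,
          integral_const_mul, Measure.real, hvol ε hε0, ENNReal.toReal_ofReal (by positivity),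
          smul_eq_mul]
        ring
    _ ≤ δ * √ε * (ε * L) + ε * √ε / δ * (η * δ / 2) := by gcongr
    _ = η * (ε * √ε) := by
        rw [hδ]
        field_simp
        ring

end Measure

/-! ### Maass forms in logarithmic coordinates. -/

section MaassForm

theorem coe_dilation_smul {κ : ℝ} (hκ : 0 < κ) (z : ℍ) :
    ((dilation κ hκ • z : ℍ) : ℂ) = κ * z := by
  have h : (√κ : ℂ) ≠ 0 := by exact_mod_cast (Real.sqrt_pos.mpr hκ).ne'
  have h2 : (√κ : ℂ) * √κ = κ := by exact_mod_cast Real.mul_self_sqrt hκ.le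
  rw [UpperHalfPlane.coe_specialLinearGroup_apply]
  simp only [dilation, Matrix.SpecialLinearGroup.coe_mk, Matrix.of_apply, Matrix.cons_val',
    Matrix.cons_val_zero, Matrix.cons_val_one, Matrix.cons_val_fin_one, Algebra.algebraMap_self,
    RingHom.id_apply]
  push_cast
  field_simp
  linear_combination (z : ℂ) * h2

variable {Γ : Subgroup PSL(2, ℝ)} {κ : ℝ} {eig : ℂ} {φ : ℍ → ℂ}

theorem comp_exp_add_log (hκ : 0 < κ)
    (hdil : (QuotientGroup.mk (dilation κ hκ) : PSL(2, ℝ)) ∈ Γ) (hφ : IsMaassForm Γ eig φ) (z : ℂ) :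
    (φ ∘ UpperHalfPlane.ofComplex) (Complex.exp (z + Real.log κ)) =
      (φ ∘ UpperHalfPlane.ofComplex) (Complex.exp z) := by
  have he : Complex.exp (z + Real.log κ) = κ * Complex.exp z := by
    rw [Complex.exp_add, ← Complex.ofReal_exp, Real.exp_log hκ, mul_comm]
  have him : (κ * Complex.exp z).im = κ * (Complex.exp z).im := Complex.im_ofReal_mul _ _
  rw [he, Function.comp_apply, Function.comp_apply]
  rcases lt_or_ge 0 (Complex.exp z).im with h | h
  · have h' : 0 < (κ * Complex.exp z).im := by rw [him]; positivity
    rw [UpperHalfPlane.ofComplex_apply_of_im_pos h, UpperHalfPlane.ofComplex_apply_of_im_pos h',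
      ← hφ.invariant _ hdil ⟨Complex.exp z, h⟩, pslMk_smul]
    congr 1
    ext
    rw [coe_dilation_smul]
  -- Off the upper half-plane `ofComplex` takes one fixed value, so periodicity holds there too.
  · have h' : (κ * Complex.exp z).im ≤ 0 := by
      rw [him]; exact mul_nonpos_of_nonneg_of_nonpos hκ.le h
    rw [UpperHalfPlane.ofComplex_apply_of_im_nonpos h,
      UpperHalfPlane.ofComplex_apply_of_im_nonpos h']

theorem eigenfunction_comp_exp (hφ : IsMaassForm Γ eig φ) {z : ℂ} (hz : z ∈ strip) :
    (Real.sin z.im : ℂ) ^ 2 *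
      (fderiv ℝ (fun y => fderiv ℝ
          (fun x => (φ ∘ UpperHalfPlane.ofComplex) (Complex.exp x)) y 1) z 1 +
        fderiv ℝ (fun y => fderiv ℝ
          (fun x => (φ ∘ UpperHalfPlane.ofComplex) (Complex.exp x)) y I) z I) =
      -eig * (φ ∘ UpperHalfPlane.ofComplex) (Complex.exp z) := by
  have h := hφ.eigenfunction ⟨Complex.exp z, exp_im_pos hz⟩
  have him : (⟨Complex.exp z, exp_im_pos hz⟩ : ℍ).im = ‖Complex.exp z‖ * Real.sin z.im := by
    rw [Complex.norm_exp]; exact Complex.exp_im z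
  rw [hypLaplacian, him, UpperHalfPlane.coe_mk] at h
  rw [laplacian_comp_exp hφ.smooth hz, Function.comp_apply,
    UpperHalfPlane.ofComplex_apply_of_im_pos (exp_im_pos hz)]
  push_cast at h ⊢
  linear_combination -h

/-- The fundamental domain witnessing square-integrability need not be the flare domain, but by
invariance the integral of `‖φ‖²` is the same over both. -/
theorem lintegral_flare_lt_top (hΓ : IsFuchsian Γ) (hφ : IsMaassForm Γ eig φ) {F : Set ℍ}
    (hF : IsFundamentalDomain Γ F) {α : ℝ} (hα : flare κ α ⊆ F) :
    ∫⁻ z in flare κ α, ENNReal.ofReal (‖φ z‖ ^ 2) < ⊤ := by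
  have := hΓ.countable
  obtain ⟨F', hF', hL2⟩ := hφ.squareIntegrable
  have h1 := lintegral_rpow_enorm_lt_top_of_eLpNorm_lt_top two_ne_zero ENNReal.ofNat_ne_top hL2.2
  have h2 : ∀ z, ‖φ z‖ₑ ^ (2 : ENNReal).toReal = ENNReal.ofReal (‖φ z‖ ^ 2) := fun z => by
    rw [ENNReal.ofReal_pow (norm_nonneg _), ofReal_norm]
    simp
  simp_rw [h2] at h1
  rw [hF'.setLIntegral_eq hF _ fun γ z => by
    rw [Subgroup.smul_def, hφ.invariant _ γ.2]] at h1
  exact (lintegral_mono_set hα).trans_lt h1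

theorem integrableOn_comp_exp (hκ : 0 < κ) (hΓ : IsFuchsian Γ)
    (hφ : IsMaassForm Γ eig φ) {F : Set ℍ} (hF : IsFundamentalDomain Γ F) {α β : ℝ}
    (hα : flare κ α ⊆ F) (hβα : β ≤ α) (hβ : β ≤ 1) :
    IntegrableOn (fun p : ℝ × ℝ =>
      ‖(φ ∘ UpperHalfPlane.ofComplex) (Complex.exp (p.2 + p.1 * I))‖ ^ 2 / p.1 ^ 2)
      (Set.Ioo 0 β ×ˢ Set.Ioo 0 (Real.log κ)) := by
  have hm : MeasurableSet (Set.Ioo 0 β ×ˢ Set.Ioo 0 (Real.log κ)) :=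
    measurableSet_Ioo.prod measurableSet_Ioo
  refine ⟨ContinuousOn.aestronglyMeasurable (ContinuousOn.div ?_ (by fun_prop) ?_) hm, ?_⟩
  · refine (((contDiffOn_comp_exp hφ.smooth).continuousOn.comp
      (f := fun p : ℝ × ℝ => (p.2 + p.1 * I : ℂ)) (by fun_prop) fun p hp => ?_).norm).pow 2
    exact mem_strip ⟨hp.1.1, by linarith [hp.1.2, Real.pi_gt_three]⟩
  · exact fun p hp => pow_ne_zero _ hp.1.1.ne'
  · have h := lintegral_logPolar_le_flare
      (fun w => ‖(φ ∘ UpperHalfPlane.ofComplex) w‖ ^ 2) (fun _ => sq_nonneg _)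
      (L := Real.log κ) hβα hβ
    simp only [Real.exp_log hκ, Function.comp_apply, UpperHalfPlane.ofComplex_apply] at h
    refine (lintegral_congr fun p => ?_).trans_lt
      (h.trans_lt (lintegral_flare_lt_top hΓ hφ hF hα))
    exact Real.enorm_of_nonneg (by positivity)

end MaassForm

end FlareExpansion

theorem mainTheorem1 (Γ : Subgroup PSL(2, ℝ)) (hΓ : FlareExpansion.IsFuchsian Γ)
    (hvol : MeasureTheory.covolume Γ ℍ = ⊤)
    (κ : ℝ) (hκ : 1 < κ)
    (hdil : (QuotientGroup.mk (FlareExpansion.dilation κ (zero_lt_one.trans hκ)) : PSL(2, ℝ)) ∈ Γ)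
    (hflare : ∃ F : Set ℍ, FlareExpansion.IsFlareDomain Γ κ F)
    (ν : ℂ) (hν : 0 ≤ ν.re)
    (φ : ℍ → ℂ) (hφ : FlareExpansion.IsMaassForm Γ (1 / 4 - ν ^ 2) φ) :
    ∃ b : ℤ → ℂ, ∀ (z : ℍ) (r θ : ℝ), r = ‖(z : ℂ)‖ → θ = Complex.arg z →
      HasSum
        (fun n : ℤ =>
          b n * (√(Real.sin θ) : ℂ) *
            FlareExpansion.legendreP (-ν) (FlareExpansion.legendreDegree κ n) (Real.cos θ) *
            FlareExpansion.e (n * (Real.log r / Real.log κ)))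
        (φ z) := by
  open FlareExpansion in
  obtain ⟨F, hF, α, hα0, hα⟩ := hflare
  have hκ0 : 0 < κ := zero_lt_one.trans hκ
  have hL : 0 < Real.log κ := Real.log_pos hκ
  have hΨ := contDiffOn_comp_exp hφ.smooth
  -- The rectangle has height `β = min α 1`, inside the flare and inside the strip.
  obtain ⟨b, hb⟩ := exists_hasSum_legendreMode hL hΨ (comp_exp_add_log hκ0 hdil hφ) hν
    (fun z hz => eigenfunction_comp_exp hφ hz)
    (mean_le_of_integrableOn hΨ.continuousOn hL (lt_min hα0 one_pos) (min_le_right _ _)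
      (integrableOn_comp_exp hκ0 hΓ hφ hF hα (min_le_left _ _) (min_le_right _ _)))
  refine ⟨b, fun z r θ hr hθ => ?_⟩
  have hz0 : (z : ℂ) ≠ 0 := z.ne_zero
  have hr0 : 0 < r := hr ▸ norm_pos_iff.mpr hz0
  have hexp : Complex.exp (Real.log r + θ * Complex.I) = z := by
    rw [Complex.exp_add, ← Complex.ofReal_exp, Real.exp_log hr0, hr, hθ,
      Complex.norm_mul_exp_arg_mul_I]
  have hmem : θ ∈ Set.Ioo 0 Real.pi := by
    have h0 : 0 ≤ Complex.arg z := Complex.arg_nonneg_iff.mpr z.im_pos.le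
    have him : (z : ℂ).im ≠ 0 := z.im_pos.ne'
    rw [hθ]
    refine ⟨h0.lt_of_ne fun h => him ?_, (Complex.arg_le_pi _).lt_of_ne fun h => him ?_⟩
    · exact (Complex.arg_eq_zero_iff.mp h.symm).2
    · exact (Complex.arg_eq_pi_iff.mp h).2
  have h := hb (Real.log r) θ hmem
  rw [hexp, Function.comp_apply, UpperHalfPlane.ofComplex_apply] at h
  convert! h using 1
  ext n
  rw [legendreMode, legendreDegree, e, fourier_coe_apply, ← mul_assoc]
  congr 2
  push_cast
  ring
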